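/- **Conventions.** Let $\mathbf V$ be a variety of groups (the class of all groups satisfying a given set of laws). A group is *$\mathbf V$-free* on a family $X$ if it lies in $\mathbf V$ and has the universal property of the free object on $X$ with respect to $\mathbf V$; $\mathcal F_{\mathbf V}$ (resp. $\mathcal F^\infty_{\mathbf V}$) is the class of $\mathbf V$-free groups (resp. those of infinite rank), the trivial group (rank $0$) included in $\mathcal F_{\mathbf V}$. $A*C$ denotes the free product (coproduct) in $\mathbf V$. For $A\le B$ in $\mathcal F_{\mathbf V}$, $A\leqslant_*^{\mathrm{ff}}B$ means that $B=A*C$ for some subgroup $C\in\mathcal F_{\mathbf V}$ of $B$. $\mathbf V$ is *torsion-free* if it is nontrivial and every $\mathbf V$-free group is torsion-free. For a structure $M$ and $S\subseteq M$, $\mathrm{dcl}^{\mathrm{qf}}_M(S)$ is the least $T\supseteq S$ that contains every element of $M$ which is the unique solution in $M$ of a quantifier-free formula with parameters in $T$. **RCP.** An *RCP-witness* is a $\mathbf V$-free group $B$ with free basis $\{b_i:i<\omega\}$ and elements $a_i\in B$ $(i<\omega)$ such that, with $A=\langle a_i:i<\omega\rangle$: (a) $A$ is $\mathbf V$-free on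 $\{a_i:i<\omega\}$ and $\langle a_j:j\le i\rangle\leqslant_*^{\mathrm{ff}}B$ for every $i$; (b) $A\not\leqslant_*^{\mathrm{ff}}B*C$ for every $C\in\mathcal F_{\mathbf V}$; (c) $\mathrm{dcl}^{\mathrm{qf}}_B(A\cup\{b_0\})=B$. $\mathbf V$ *satisfies RCP* if an RCP-witness exists. **AEC-coverings.** An abstract elementary class (AEC) $(\mathcal K,\preccurlyeq)$ in the language $L$ of groups is a class of $L$-structures with a partial order $\preccurlyeq$ refining the substructure relation, closed under isomorphism, and satisfying the Tarski–Vaught chain axioms (unions of increasing continuous $\preccurlyeq$-chains, including smoothness), coherence and the Löwenheim–Skolem–Tarski axiom. It is an *AEC-covering of $(\mathcal F_{\mathbf V},\leqslant_*^{\mathrm{ff}})$* if $\mathcal F^\infty_{\mathbf V}\subseteq\mathcal K$; for $G,H\in\mathcal F_{\mathbf V}\cap\mathcal K$, $G\leqslant_*^{\mathrm{ff}}H$ implies $G\preccurlyeq H$; and $(\mathcal K,\preccurlyeq)$ has the amalgamation and joint embedding properties. It is *strong enough with respect to an RCP-witness* $(B,(a_i),(b_i))$, $A=\langle a_i:i<\omega\rangle$,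 if (i) for $X,Y,Z\in\mathcal F^\infty_{\mathbf V}$, $X\preccurlyeq Y$ implies $X*Z\preccurlyeq Y*Z$ (i.e. the canonical map is injective with image $\preccurlyeq Y*Z$); (ii) if $B\preccurlyeq M\in\mathcal K$, then $\mathrm{dcl}^{\mathrm{qf}}_B(A\cup\{b_0\})=\mathrm{dcl}^{\mathrm{qf}}_M(A\cup\{b_0\})$; (iii) for all sufficiently large $\kappa$ and every $(\kappa,\preccurlyeq)$-universal and $(\kappa,\preccurlyeq)$-homogeneous (monster) model $\mathfrak M\in\mathcal K$ with $B\preccurlyeq\mathfrak M$, and every $f\in\mathrm{Aut}(\mathfrak M)$ fixing $A$ pointwise, $\mathrm{dcl}^{\mathrm{qf}}_{\mathfrak M}(A\cup\{b_0\})=\mathrm{dcl}^{\mathrm{qf}}_{\mathfrak M}(A\cup\{f(b_0)\})$. Here $(\kappa,\preccurlyeq)$-universal means that every $N\in\mathcal K$ with $|N|\le\kappa$ embeds strongly into $\mathfrak M$, and $(\kappa,\preccurlyeq)$-homogeneous means that every isomorphism between strong submodels of $\mathfrak M$ of size $<\kappa$ extends to an automorphism of $\mathfrak M$. In (ii) and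 (iii), $B$ may be replaced by any isomorphic copy. $(\mathcal K,\preccurlyeq)$ is *$\lambda$-stable* if there are at most $\lambda$ Galois types (of single elements) over each $M\in\mathcal K$ of size $\lambda$, and *superstable* if there is $\mu$ such that it is $\lambda$-stable for all $\lambda\ge\mu$. **Corollary.** Let $\mathbf V$ be a torsion-free variety of groups such that, whenever $F$ is $\mathbf V$-free on a set $X$, $x\in X$, $y\in F$ and $0<n<\omega$, $x^n=y^n$ implies $x=y$. Then: 1. If $B$ is $\mathbf V$-free on $\{b_i:i<\omega\}$ and $a_i=b_ib_{i+1}^{-2}$, then $(B,(a_i),(b_i))$ is an RCP-witness. In particular, $\mathbf V$ satisfies RCP. 2. If $(\mathcal K,\preccurlyeq)$ is an AEC-covering of $(\mathcal F_{\mathbf V},\leqslant_*^{\mathrm{ff}})$ that is strong enough with respect to some RCP-witness, then $(\mathcal K,\preccurlyeq)$ is not superstable. -/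

import Mathlib

open FirstOrder Cardinal

universe u w

namespace ConstructionPrinciple

/-! ### Abstract elementary classes -/

section AEC

variable {L : FirstOrder.Language.{0, 0}}

/-- An element `x` is quantifier-free definable over a set `T` in `M` if it is the unique solution
in `M` of a quantifier-free formula with parameters from `T`. -/
def IsQFDefinable (L : FirstOrder.Language.{0, 0}) {M : Type w} [L.Structure M] (T : Set M) (x : M) : Prop :=
  ∃ φ : L.Formula (T ⊕ Unit), φ.IsQF ∧
    ∀ y : M, φ.Realize (Sum.elim (fun t : T => (t : M)) (fun _ => y)) ↔ y = x

/-- The quantifier-free definable closure of `S` in `M`: the least set that contains `S` and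
every element quantifier-free definable over it. -/
def dclQF (L : FirstOrder.Language.{0, 0}) {M : Type w} [L.Structure M] (S : Set M) : Set M :=
  ⋂₀ {T : Set M | S ⊆ T ∧ ∀ x, IsQFDefinable L T x → x ∈ T}

/-- An `L`-structure, bundled. -/
abbrev asStr (L : FirstOrder.Language.{0, 0}) (M : Type w) [L.Structure M] :
    CategoryTheory.Bundled.{w} L.Structure :=
  CategoryTheory.Bundled.of M

/-- A class of `L`-structures with a binary relation: `S ∈ K.strong N` means that the substructure
`S` of `N` satisfies `S ≼ N`. -/
structure AbstractClass (L : FirstOrder.Language.{0, 0}) where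
  mod : Set (CategoryTheory.Bundled.{w} L.Structure)
  strong : (N : CategoryTheory.Bundled.{w} L.Structure) → Set (L.Substructure N)

namespace AbstractClass

variable (K : AbstractClass.{w} L)

/-- `S ≼ T`, for substructures `S`, `T` of a common structure `N`. -/
def StrongLE {N : Type w} [L.Structure N] (S T : L.Substructure N) : Prop :=
  S ≤ T ∧ S.comap T.subtype.toHom ∈ K.strong (asStr L T)

/-- Strong embeddings: the image is a strong submodel. -/
def IsStrongEmb {M N : CategoryTheory.Bundled.{w} L.Structure} (f : M ↪[L] N) : Prop :=
  f.toHom.range ∈ K.strong N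

/-- `S` is an increasing continuous `≼`-chain of length `δ`, inside an `L`-structure `N` (which
need not be a member of the class). -/
structure IsChain {N : Type w} [L.Structure N] (δ : Ordinal.{w})
    (S : Ordinal.{w} → L.Substructure N) : Prop where
  mem : ∀ i < δ, asStr L (S i) ∈ K.mod
  mono : ∀ i j, i ≤ j → j < δ → K.StrongLE (S i) (S j)
  cont : ∀ j < δ, Order.IsSuccLimit j → S j = ⨆ i : Set.Iio j, S i

/-- Abstract elementary classes. -/
structure IsAEC : Prop where
  /-- `≼` is a relation on the class. -/
  mem_of_strong : ∀ N, ∀ S ∈ K.strong N, N ∈ K.mod ∧ asStr L S ∈ K.mod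
  mod_iso : ∀ M N : CategoryTheory.Bundled.{w} L.Structure, M ∈ K.mod → (M ≃[L] N) → N ∈ K.mod
  strong_iso : ∀ (M N : CategoryTheory.Bundled.{w} L.Structure) (e : M ≃[L] N),
    ∀ S ∈ K.strong M, S.map e.toHom ∈ K.strong N
  refl : ∀ N ∈ K.mod, ⊤ ∈ K.strong N
  trans : ∀ (N : CategoryTheory.Bundled.{w} L.Structure) (S T : L.Substructure N),
    K.StrongLE S T → T ∈ K.strong N → S ∈ K.strong N
  /-- The union of a chain is in the class, and is a strong extension of its members. -/
  chain_union : ∀ (N : CategoryTheory.Bundled.{w} L.Structure) (δ : Ordinal.{w})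
    (S : Ordinal.{w} → L.Substructure N), Order.IsSuccLimit δ → K.IsChain δ S →
      asStr L ↥(⨆ i : Set.Iio δ, S i) ∈ K.mod ∧
      ∀ j < δ, K.StrongLE (S j) (⨆ i : Set.Iio δ, S i)
  /-- Smoothness. -/
  smooth : ∀ (N : CategoryTheory.Bundled.{w} L.Structure) (δ : Ordinal.{w})
    (S : Ordinal.{w} → L.Substructure N), Order.IsSuccLimit δ → K.IsChain δ S →
      (∀ i < δ, S i ∈ K.strong N) → (⨆ i : Set.Iio δ, S i) ∈ K.strong N
  /-- Coherence. -/
  coherence : ∀ (N : CategoryTheory.Bundled.{w} L.Structure) (S T : L.Substructure N),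
    S ∈ K.strong N → T ∈ K.strong N → S ≤ T → K.StrongLE S T
  /-- The Löwenheim–Skolem–Tarski axiom. -/
  lowenheimSkolem : ∃ μ : Cardinal.{w}, Cardinal.lift.{w} L.card + ℵ₀ ≤ μ ∧
    ∀ N ∈ K.mod, ∀ Y : Set N, ∃ S ∈ K.strong N, Y ⊆ (S : Set N) ∧ #S ≤ #Y + μ

/-- The amalgamation property. -/
def HasAP : Prop :=
  ∀ (M N₁ N₂ : CategoryTheory.Bundled.{w} L.Structure) (f₁ : M ↪[L] N₁) (f₂ : M ↪[L] N₂),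
    M ∈ K.mod → K.IsStrongEmb f₁ → K.IsStrongEmb f₂ →
    ∃ (P : CategoryTheory.Bundled.{w} L.Structure) (g₁ : N₁ ↪[L] P) (g₂ : N₂ ↪[L] P),
      K.IsStrongEmb g₁ ∧ K.IsStrongEmb g₂ ∧ ∀ x : M, g₁ (f₁ x) = g₂ (f₂ x)

/-- The joint embedding property. -/
def HasJEP : Prop :=
  ∀ N₁ N₂ : CategoryTheory.Bundled.{w} L.Structure, N₁ ∈ K.mod → N₂ ∈ K.mod →
    ∃ (P : CategoryTheory.Bundled.{w} L.Structure) (g₁ : N₁ ↪[L] P) (g₂ : N₂ ↪[L] P),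
      K.IsStrongEmb g₁ ∧ K.IsStrongEmb g₂

/-- `M` is a monster model for the cardinal `κ`: it is `(κ, ≼)`-universal and
`(κ, ≼)`-homogeneous. -/
structure IsMonster (κ : Cardinal.{w}) (M : CategoryTheory.Bundled.{w} L.Structure) : Prop where
  mem : M ∈ K.mod
  universal : ∀ N ∈ K.mod, #N ≤ κ → ∃ f : N ↪[L] M, K.IsStrongEmb f
  homogeneous : ∀ S ∈ K.strong M, ∀ T ∈ K.strong M, #S < κ → #T < κ → ∀ e : S ≃[L] T,
    ∃ π : M ≃[L] M, ∀ x : S, π x = e x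

/-- An element of a strong extension of `M`. -/
structure PreType (M : CategoryTheory.Bundled.{w} L.Structure) where
  ext : CategoryTheory.Bundled.{w} L.Structure
  emb : M ↪[L] ext
  isStrong : K.IsStrongEmb emb
  elt : ext

/-- Two elements of strong extensions of `M` are identified by strong embeddings over `M`
into a common extension. -/
def PreType.Rel {K : AbstractClass.{w} L} {M : CategoryTheory.Bundled.{w} L.Structure}
    (p q : K.PreType M) : Prop :=
  ∃ (P : CategoryTheory.Bundled.{w} L.Structure) (g : p.ext ↪[L] P) (h : q.ext ↪[L] P),
    K.IsStrongEmb g ∧ K.IsStrongEmb h ∧ (∀ x : M, g (p.emb x) = h (q.emb x)) ∧ g p.elt = h q.elt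

/-- Galois types (of elements) over `M`: the quotient by the equivalence relation generated by
`PreType.Rel` (which is itself an equivalence relation when amalgamation holds). -/
def GaloisType (M : CategoryTheory.Bundled.{w} L.Structure) : Type (w + 1) :=
  Quot (PreType.Rel (K := K) (M := M))

/-- `λ`-stability: there are at most `λ` Galois types over every model of cardinality `λ`. -/
def IsStableIn (lam : Cardinal.{w}) : Prop :=
  ∀ M ∈ K.mod, #M = lam → #(K.GaloisType M) ≤ Cardinal.lift.{w + 1} lam

/-- Superstability: stability in all cardinals of some tail. -/
def IsSuperstable : Prop :=
  ∃ μ : Cardinal.{w}, ∀ lam : Cardinal.{w}, μ ≤ lam → K.IsStableIn lam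

end AbstractClass

end AEC

/-! ### Groups as first-order structures -/

/-- The function symbols of the language of groups. -/
inductive GroupFunc : ℕ → Type
  | one : GroupFunc 0
  | inv : GroupFunc 1
  | mul : GroupFunc 2

/-- The language of groups. -/
def groupLang : FirstOrder.Language.{0, 0} where
  Functions := GroupFunc
  Relations := fun _ => Empty

/-- Every group is a structure in the language of groups. -/
instance groupStructure (G : Type u) [Group G] : groupLang.Structure G where
  funMap := fun {_} f x =>
    match f, x with
    | GroupFunc.one, _ => 1
    | GroupFunc.inv, x => (x 0)⁻¹
    | GroupFunc.mul, x => x 0 * x 1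
  RelMap := fun {_} r _ => nomatch r

/-- A subgroup as a substructure. -/
def toSub {G : Type u} [Group G] (A : Subgroup G) : groupLang.Substructure G where
  carrier := A
  fun_mem := fun {_} f x hx => by
    match f, x, hx with
    | GroupFunc.one, _, _ => exact A.one_mem
    | GroupFunc.inv, x, hx => exact A.inv_mem (hx 0)
    | GroupFunc.mul, x, hx => exact A.mul_mem (hx 0) (hx 1)

/-! ### Varieties of groups and their free objects

A variety is given by a set `W` of laws, words in countably many letters. -/

section Variety

variable (W : Set (FreeGroup ℕ))

/-- The group `G` belongs to the variety defined by the laws in `W`. -/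
def InVariety (G : Type u) [Group G] : Prop :=
  ∀ r ∈ W, ∀ v : ℕ → G, FreeGroup.lift v r = 1

/-- `G` belongs to the variety and is freely generated in it by the family `b`. -/
def IsFreeBasis {ι : Type w} {G : Type u} [Group G] (b : ι → G) : Prop :=
  InVariety W G ∧ ∀ (H : Type u) [Group H], InVariety W H → ∀ f : ι → H,
    ∃! φ : G →* H, ∀ i, φ (b i) = f i

/-- `G` is a free object of the variety. -/
def IsFree (G : Type u) [Group G] : Prop :=
  ∃ X : Set G, IsFreeBasis W (fun x : X => (x : G))

/-- `G` is a free object of infinite rank of the variety. -/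
def IsFreeInf (G : Type u) [Group G] : Prop :=
  ∃ X : Set G, X.Infinite ∧ IsFreeBasis W (fun x : X => (x : G))

/-- `D`, with the homomorphisms `β` and `γ`, is the free product `B * C` in the variety. -/
def IsFreeProduct {B C D : Type u} [Group B] [Group C] [Group D] (β : B →* D) (γ : C →* D) :
    Prop :=
  InVariety W D ∧ ∀ (H : Type u) [Group H], InVariety W H → ∀ (f : B →* H) (g : C →* H),
    ∃! φ : D →* H, φ.comp β = f ∧ φ.comp γ = g

/-- `A` is a free factor, with free complement, of the free object `G`; here `A` is free too. -/
def IsFreeFactor {G : Type u} [Group G] (A : Subgroup G) : Prop :=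
  IsFree W G ∧ IsFree W A ∧ ∃ C : Subgroup G, IsFree W C ∧ IsFreeProduct W A.subtype C.subtype

/-- The variety is nontrivial and its free objects are torsion-free. -/
def IsTorsionFreeVariety : Prop :=
  (∃ (G : Type u) (_ : Group G), InVariety W G ∧ Nontrivial G) ∧
  ∀ (G : Type u) [Group G], IsFree W G → ∀ (x : G) (n : ℕ), 0 < n → x ^ n = 1 → x = 1

/-- The group `B`, its free basis `b` and the subgroup `A` generated by the family `a` are a
witness of the Reinforced Construction Principle. -/
structure IsRCPWitness (B : Type u) [Group B] (a b : ℕ → B) : Prop where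
  free_b : IsFreeBasis W b
  free_a : IsFreeBasis W
    (fun i => (⟨a i, Subgroup.subset_closure ⟨i, rfl⟩⟩ : Subgroup.closure (Set.range a)))
  initial_factor : ∀ i : ℕ, IsFreeFactor W (Subgroup.closure (a '' {j | j ≤ i}))
  not_factor : ∀ (C D : Type u) [Group C] [Group D] (β : B →* D) (γ : C →* D),
    IsFree W C → IsFreeProduct W β γ → ¬ IsFreeFactor W ((Subgroup.closure (Set.range a)).map β)
  dcl_eq : dclQF groupLang ((Subgroup.closure (Set.range a) : Set B) ∪ {b 0}) = Set.univ

/-- The Reinforced Construction Principle. -/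
def RCP : Prop :=
  ∃ (B : Type u) (_ : Group B) (a b : ℕ → B), IsRCPWitness W B a b

/-- `K` is an AEC-covering of the class of free objects with the relation of being a free factor
with free complement. -/
structure IsAECCovering (K : AbstractClass.{u} groupLang) : Prop where
  free_mem : ∀ (G : Type u) [Group G], IsFreeInf W G → asStr groupLang G ∈ K.mod
  isAEC : K.IsAEC
  strong_of_factor : ∀ (G : Type u) [Group G] (A : Subgroup G), asStr groupLang G ∈ K.mod →
    asStr groupLang A ∈ K.mod → IsFreeFactor W A → toSub A ∈ K.strong (asStr groupLang G)
  ap : K.HasAP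
  jep : K.HasJEP

/-- `K` is strong enough, with respect to the pair of the group `B`, with free basis `b`, and its
subgroup `A` generated by the family `a`. -/
structure IsStrongEnough (K : AbstractClass.{u} groupLang) (B : Type u) [Group B]
    (a b : ℕ → B) : Prop where
  /-- If `X ≼ Y` then the canonical homomorphism `θ : X * Z → Y * Z` is a strong embedding. -/
  free_product : ∀ (Y Z P Q : Type u) [Group Y] [Group Z] [Group P] [Group Q] (X : Subgroup Y)
    (ξ : X →* P) (ζ : Z →* P) (η : Y →* Q) (ζ' : Z →* Q) (θ : P →* Q),
    IsFreeInf W X → IsFreeInf W Y → IsFreeInf W Z → toSub X ∈ K.strong (asStr groupLang Y) →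
    IsFreeProduct W ξ ζ → IsFreeProduct W η ζ' →
    θ.comp ξ = η.comp X.subtype → θ.comp ζ = ζ' →
    Function.Injective θ ∧ toSub θ.range ∈ K.strong (asStr groupLang Q)
  /-- If `B ≼ M`, then `A ∪ {b 0}` has the same quantifier-free definable closure in `B`
  and in `M`. -/
  dcl_eq : ∀ (M : CategoryTheory.Bundled.{u} groupLang.Structure)
    (j : asStr groupLang B ↪[groupLang] M), K.IsStrongEmb j →
    j '' dclQF groupLang ((Subgroup.closure (Set.range a) : Set B) ∪ {b 0}) =
      dclQF groupLang (j '' ((Subgroup.closure (Set.range a) : Set B) ∪ {b 0}))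
  /-- If `B ≼ M` for a sufficiently large monster model `M`, and `f` is an automorphism of `M`
  fixing `A` pointwise, then `A ∪ {b 0}` and `A ∪ {f (b 0)}` have the same quantifier-free
  definable closure in `M`. -/
  dcl_aut : ∃ κ₀ : Cardinal.{u}, ∀ κ, κ₀ ≤ κ →
    ∀ M : CategoryTheory.Bundled.{u} groupLang.Structure, K.IsMonster κ M →
    ∀ j : asStr groupLang B ↪[groupLang] M, K.IsStrongEmb j →
    ∀ f : M ≃[groupLang] M, (∀ x ∈ Subgroup.closure (Set.range a), f (j x) = j x) →
    dclQF groupLang (j '' (Subgroup.closure (Set.range a) : Set B) ∪ {j (b 0)}) =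
      dclQF groupLang (j '' (Subgroup.closure (Set.range a) : Set B) ∪ {f (j (b 0))})

end Variety

end ConstructionPrinciple

open ConstructionPrinciple

/-!
Modulo `A = ⟨a 0, a 1, …⟩`, each `b (i + 1)` is a square root of `b i`. If `A` were a free factor of
`B * C`, the quotient of `B * C` by the normal closure of `A` would be free, and `b 0`, having roots
of order `2 ^ n` for all `n`, would vanish in its abelianization, hence under every homomorphism
from `B * C` to an abelian group that kills `A`. But `b i ↦ 2 ^ (-i)` extends to such a homomorphism
to `ℚ`. On the other hand `A` and `b 0` determine all `b i`, by uniqueness of square roots.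

For the failure of superstability, take `λ` with `λ ^ ℵ₀ > λ`, a set `I` of cardinality `λ`, and `M`
free on the finite sequences in `I`. Each branch `ν : ℕ → I` embeds `A` in `M`, sending `a i` to the
generator at `ν ↾ i`, and the pushout of `M` and `B` over `A` is a strong extension of `M`. Here
`b 0` realizes a Galois type over `M`, and different branches give different types: branches that
split after `k` share only `a 0, …, a k`, which generate a free factor of `B`, so their extensions
can be amalgamated with `b 0` of one outside of the copy of `B` in the other.
-/

namespace ConstructionPrinciple

namespace AbstractClass

open FirstOrder.Language CategoryTheory

variable {L : FirstOrder.Language.{0, 0}} {K : AbstractClass.{w} L}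

/-- Membership in the class, for unbundled structures. -/
def Mem (K : AbstractClass.{w} L) (M : Type w) [L.Structure M] : Prop := asStr L M ∈ K.mod

/-- Strong embeddings of unbundled structures. -/
def Strong (K : AbstractClass.{w} L) {M N : Type w} [L.Structure M] [L.Structure N]
    (f : M ↪[L] N) : Prop :=
  f.toHom.range ∈ K.strong (asStr L N)

/-- `U` is the least upper bound of the family `S` in the relation `≼`. The union of a chain in an
abstract elementary class is one, by the chain axioms. -/
structure IsStrongLUB (K : AbstractClass.{w} L) {ι : Sort*} {N : Type w} [L.Structure N]
    (S : ι → L.Substructure N) (U : L.Substructure N) : Prop where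
  strongLE : ∀ i, K.StrongLE (S i) U
  least : ∀ T : L.Substructure N, (∀ i, K.StrongLE (S i) T) → K.StrongLE U T

variable {M N P : Type w} [L.Structure M] [L.Structure N] [L.Structure P]

theorem strong_congr {f g : M ↪[L] N} (hfg : ∀ x, f x = g x) (hf : K.Strong f) : K.Strong g :=
  Embedding.ext hfg ▸ hf

theorem strong_subtype_iff {S : L.Substructure N} :
    K.Strong S.subtype ↔ S ∈ K.strong (asStr L N) := by
  rw [Strong, Substructure.range_subtype]

theorem map_comap_of_le_range {f : M ↪[L] N} {S : L.Substructure N} (h : S ≤ f.toHom.range) :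
    (S.comap f.toHom).map f.toHom = S := by
  refine le_antisymm Substructure.map_comap_le fun x hx => ?_
  obtain ⟨y, rfl⟩ := h hx
  exact ⟨y, hx, rfl⟩

theorem comap_subtype_eq_range_inclusion {S T : L.Substructure N} (h : S ≤ T) :
    S.comap T.subtype.toHom = (Substructure.inclusion h).toHom.range := by
  ext x
  exact ⟨fun hx => ⟨⟨x, hx⟩, rfl⟩, by rintro ⟨y, rfl⟩; exact y.2⟩

theorem strongLE_iff_strong_inclusion {S T : L.Substructure N} :
    K.StrongLE S T ↔ ∃ h : S ≤ T, K.Strong (Substructure.inclusion h) := by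
  rw [StrongLE, ← exists_prop]
  exact exists_congr fun h => by rw [comap_subtype_eq_range_inclusion h, Strong]

namespace IsAEC

variable (hK : K.IsAEC)
include hK

theorem mem_of_equiv (e : M ≃[L] N) (hM : K.Mem M) : K.Mem N :=
  hK.mod_iso (asStr L M) (asStr L N) hM e

theorem mem_codomain {f : M ↪[L] N} (hf : K.Strong f) : K.Mem N :=
  (hK.mem_of_strong (asStr L N) _ hf).1

theorem mem_domain {f : M ↪[L] N} (hf : K.Strong f) : K.Mem M :=
  hK.mem_of_equiv f.equivRange.symm (hK.mem_of_strong (asStr L N) _ hf).2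

theorem strong_equiv (e : M ≃[L] N) (hM : K.Mem M) : K.Strong e.toEmbedding := by
  rw [Strong, show e.toEmbedding.toHom.range = ⊤ from e.toHom_range]
  exact hK.refl (asStr L N) (hK.mem_of_equiv e hM)

theorem strong_refl (hM : K.Mem M) : K.Strong (Embedding.refl L M) :=
  hK.strong_equiv (Language.Equiv.refl L M) hM

theorem strong_comp {f : M ↪[L] N} {g : N ↪[L] P} (hf : K.Strong f) (hg : K.Strong g) :
    K.Strong (g.comp f) := by
  have hrange : (g.comp f).toHom.range.comap g.toHom.range.subtype.toHom =
      f.toHom.range.map g.equivRange.toHom := by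
    ext x
    constructor
    · rintro ⟨y, hy⟩
      exact ⟨f y, ⟨y, rfl⟩, Subtype.ext hy⟩
    · rintro ⟨_, ⟨y, rfl⟩, rfl⟩
      exact ⟨y, rfl⟩
  refine hK.trans (asStr L P) (g.comp f).toHom.range g.toHom.range ⟨?_, ?_⟩ hg
  · rintro _ ⟨x, rfl⟩
    exact ⟨f x, rfl⟩
  · have hmap : f.toHom.range.map g.equivRange.toHom ∈ K.strong (asStr L g.toHom.range) :=
      hK.strong_iso (asStr L N) (asStr L g.toHom.range) g.equivRange f.toHom.range hf
    rw [← hrange] at hmap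
    exact hmap

theorem strong_of_comp {f : M ↪[L] N} {g : N ↪[L] P} (hgf : K.Strong (g.comp f))
    (hg : K.Strong g) : K.Strong f := by
  have hrange : ((g.comp f).toHom.range.comap g.toHom.range.subtype.toHom).map
      g.equivRange.symm.toHom = f.toHom.range := by
    ext x
    constructor
    · rintro ⟨z, ⟨y, hy⟩, rfl⟩
      obtain rfl : z = g.equivRange (f y) := Subtype.ext hy.symm
      exact ⟨y, (g.equivRange.symm_apply_apply _).symm⟩
    · rintro ⟨y, rfl⟩
      exact ⟨g.equivRange (f y), ⟨y, rfl⟩, g.equivRange.symm_apply_apply _⟩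
  have hle : (g.comp f).toHom.range ≤ g.toHom.range := by
    rintro _ ⟨x, rfl⟩
    exact ⟨f x, rfl⟩
  have hcoh := hK.coherence (asStr L P) _ _ hgf hg hle
  rw [Strong, ← hrange]
  exact hK.strong_iso (asStr L g.toHom.range) (asStr L N) g.equivRange.symm _ hcoh.2

theorem strongLE_top_iff {S : L.Substructure N} :
    K.StrongLE S ⊤ ↔ S ∈ K.strong (asStr L N) := by
  rw [strongLE_iff_strong_inclusion, ← strong_subtype_iff]
  constructor
  · rintro ⟨_, hS⟩
    exact hK.strong_comp hS (hK.strong_equiv Substructure.topEquiv (hK.mem_codomain hS))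
  · intro hS
    have htop : K.Strong (Substructure.topEquiv (L := L) (M := N)).toEmbedding :=
      hK.strong_equiv _ (hK.mem_of_equiv Substructure.topEquiv.symm (hK.mem_codomain hS))
    exact ⟨le_top, hK.strong_of_comp (g := Substructure.topEquiv.toEmbedding) hS htop⟩

theorem strongLE_map_iff (f : M ↪[L] N) {S T : L.Substructure M} :
    K.StrongLE (S.map f.toHom) (T.map f.toHom) ↔ K.StrongLE S T := by
  let eS := f.substructureEquivMap S
  let eT := f.substructureEquivMap T
  rw [strongLE_iff_strong_inclusion, strongLE_iff_strong_inclusion]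
  constructor
  · rintro ⟨h, hST⟩
    refine ⟨(Substructure.map_le_map_iff_of_injective (f := f.toHom) f.injective).1 h, ?_⟩
    have heS : K.Strong eS.toEmbedding :=
      hK.strong_equiv eS (hK.mem_of_equiv eS.symm (hK.mem_domain hST))
    have heT : K.Strong eT.toEmbedding :=
      hK.strong_equiv eT (hK.mem_of_equiv eT.symm (hK.mem_codomain hST))
    exact hK.strong_of_comp (f := Substructure.inclusion _) (g := eT.toEmbedding)
      (hK.strong_comp (f := eS.toEmbedding) (g := Substructure.inclusion h) heS hST) heT
  · rintro ⟨h, hST⟩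
    have heS : K.Strong eS.toEmbedding := hK.strong_equiv eS (hK.mem_domain hST)
    have heSsymm : K.Strong eS.symm.toEmbedding :=
      hK.strong_equiv eS.symm (hK.mem_codomain heS)
    have heT : K.Strong eT.toEmbedding := hK.strong_equiv eT (hK.mem_codomain hST)
    refine ⟨(Substructure.map_le_map_iff_of_injective (f := f.toHom) f.injective).2 h,
      strong_congr (fun x => ?_) (hK.strong_comp heSsymm (hK.strong_comp hST heT))⟩
    obtain ⟨y, rfl⟩ := eS.surjective x
    exact congrArg (fun z => eT (Substructure.inclusion h z)) (eS.symm_apply_apply y)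

theorem strongLE_trans {S T R : L.Substructure N} (hST : K.StrongLE S T) (hTR : K.StrongLE T R) :
    K.StrongLE S R := by
  obtain ⟨h, hST⟩ := strongLE_iff_strong_inclusion.1 hST
  obtain ⟨h', hTR⟩ := strongLE_iff_strong_inclusion.1 hTR
  exact strongLE_iff_strong_inclusion.2 ⟨h.trans h', hK.strong_comp hST hTR⟩

theorem mem_of_strongLE {S T : L.Substructure N} (h : K.StrongLE S T) : K.Mem S :=
  let ⟨_, hST⟩ := strongLE_iff_strong_inclusion.1 h
  hK.mem_domain hST

theorem isStrongLUB_of_isChain {δ : Ordinal.{w}} {S : Ordinal.{w} → L.Substructure N}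
    (hδ : Order.IsSuccLimit δ) (hS : K.IsChain δ S) :
    K.IsStrongLUB (fun i : Set.Iio δ => S i) (⨆ i : Set.Iio δ, S i) := by
  refine ⟨fun i => (hK.chain_union (asStr L N) δ S hδ hS).2 i i.2, fun T hT => ?_⟩
  let S' : Ordinal.{w} → L.Substructure T := fun i => (S i).comap T.subtype.toHom
  have hmap : ∀ i < δ, (S' i).map T.subtype.toHom = S i := fun i hi =>
    map_comap_of_le_range ((hT ⟨i, hi⟩).1.trans_eq (Substructure.range_subtype T).symm)
  have hsup : ∀ j ≤ δ, (⨆ i : Set.Iio j, S' i).map T.subtype.toHom = ⨆ i : Set.Iio j, S i :=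
    fun j hj => by
      rw [Substructure.map_iSup]
      exact iSup_congr fun i => hmap i (i.2.trans_le hj)
  have hstrong : ∀ i < δ, S' i ∈ K.strong (asStr L T) := fun i hi => (hT ⟨i, hi⟩).2
  have hchain : K.IsChain δ S' := by
    refine ⟨fun i hi => (hK.mem_of_strong _ _ (hstrong i hi)).2, fun i j hij hj => ?_,
      fun j hj hlim => ?_⟩
    · rw [← hK.strongLE_map_iff T.subtype, hmap i (hij.trans_lt hj), hmap j hj]
      exact hS.mono i j hij hj
    · apply Substructure.map_injective_of_injective (f := T.subtype.toHom) T.subtype.injective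
      rw [hmap j hj, hsup j hj.le]
      exact hS.cont j hj hlim
  have hstrongLE : K.StrongLE (⨆ i : Set.Iio δ, S' i) ⊤ :=
    hK.strongLE_top_iff.2 (hK.smooth (asStr L T) δ S' hδ hchain hstrong)
  rwa [← hK.strongLE_map_iff T.subtype, hsup δ le_rfl, ← Hom.range_eq_map,
    Substructure.range_subtype] at hstrongLE

/-- The chain axioms are about continuous chains. An arbitrary chain is made continuous by replacing
its terms at limits with the unions of the previous ones, which does not change its union. -/
theorem isStrongLUB_iSup_of_isSuccLimit {δ : Ordinal.{w}} (hδ : Order.IsSuccLimit δ)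
    {S : Ordinal.{w} → L.Substructure N}
    (hS : ∀ i j, i ≤ j → j < δ → K.StrongLE (S i) (S j)) :
    K.IsStrongLUB (fun i : Set.Iio δ => S i) (⨆ i : Set.Iio δ, S i) := by
  classical
  induction δ using WellFoundedLT.induction with
  | ind δ IH =>
  let U : Ordinal.{w} → L.Substructure N := fun j =>
    if Order.IsSuccLimit j then ⨆ i : Set.Iio j, S i else S j
  have hU_limit : ∀ j, Order.IsSuccLimit j → U j = ⨆ i : Set.Iio j, S i := fun j hj => if_pos hj
  have hlimit : ∀ j < δ, Order.IsSuccLimit j →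
      K.IsStrongLUB (fun i : Set.Iio j => S i) (U j) := fun j hj hlim => by
    rw [hU_limit j hlim]
    exact IH j hj hlim fun i k hik hk => hS i k hik (hk.trans hj)
  have hUS : ∀ j < δ, K.StrongLE (U j) (S j) := fun j hj => by
    by_cases hlim : Order.IsSuccLimit j
    · exact (hlimit j hj hlim).least _ fun i => hS i j i.2.le hj
    · simpa only [U, if_neg hlim] using hS j j le_rfl hj
  have hSU : ∀ i j, i < j → j < δ → K.StrongLE (S i) (U j) := fun i j hij hj => by
    by_cases hlim : Order.IsSuccLimit j
    · exact (hlimit j hj hlim).strongLE ⟨i, hij⟩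
    · simpa only [U, if_neg hlim] using hS i j hij.le hj
  have hsup : ∀ j ≤ δ, Order.IsSuccLimit j → ⨆ i : Set.Iio j, U i = ⨆ i : Set.Iio j, S i := by
    refine fun j hj hlim => le_antisymm (iSup_mono fun i => (hUS i (i.2.trans_le hj)).1)
      (iSup_le fun i => ?_)
    have hi : Order.succ i.1 < j := hlim.succ_lt i.2
    exact (hSU i _ (Order.lt_succ i.1) (hi.trans_le hj)).1.trans
      (le_iSup (fun i : Set.Iio j => U i) ⟨_, hi⟩)
  have hchain : K.IsChain δ U := by
    refine ⟨fun i hi => hK.mem_of_strongLE (hUS i hi), fun i j hij hj => ?_, fun j hj hlim => ?_⟩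
    · rcases hij.eq_or_lt with rfl | hij
      · exact strongLE_iff_strong_inclusion.2
          ⟨le_rfl, hK.strong_refl (hK.mem_of_strongLE (hUS i hj))⟩
      · exact hK.strongLE_trans (hUS i (hij.trans hj)) (hSU i j hij hj)
    · rw [hsup j hj.le hlim, hU_limit j hlim]
  have hLUB := hK.isStrongLUB_of_isChain hδ hchain
  rw [hsup δ le_rfl hδ] at hLUB
  refine ⟨fun i => ?_, fun T hT => hLUB.least T fun i => hK.strongLE_trans (hUS i i.2) (hT i)⟩
  exact hK.strongLE_trans (hSU i _ (Order.lt_succ i.1) (hδ.succ_lt i.2))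
    (hLUB.strongLE ⟨_, hδ.succ_lt i.2⟩)

theorem isStrongLUB_iSup {J : Type w} [LinearOrder J] [WellFoundedLT J] [Nonempty J]
    {S : J → L.Substructure N} (hS : ∀ i j, i ≤ j → K.StrongLE (S i) (S j)) :
    K.IsStrongLUB S (⨆ j, S j) := by
  rcases topOrderOrNoTopOrder J with _ | _
  · have hsup : ⨆ j, S j = S ⊤ :=
      le_antisymm (iSup_le fun j => (hS j ⊤ le_top).1) (le_iSup S ⊤)
    exact hsup ▸ ⟨fun j => hS j ⊤ le_top, fun T hT => hT ⊤⟩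
  have : NoMaxOrder J := NoTopOrder.to_noMaxOrder J
  let δ : Ordinal.{w} := Ordinal.type (α := J) (· < ·)
  have hδ : Order.IsSuccLimit δ :=
    ⟨not_isMin_iff_ne_bot.2 (Ordinal.type_ne_zero_of_nonempty _), Ordinal.isSuccPrelimit_type_lt⟩
  let e : Set.Iio δ ≃o J := OrderIso.ofRelIsoLT (Ordinal.enum (α := J) (· < ·))
  let U : Ordinal.{w} → L.Substructure N := fun i => if hi : i < δ then S (e ⟨i, hi⟩) else ⊥
  have hU : ∀ i : Set.Iio δ, U i = S (e i) := fun i => dif_pos i.2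
  have hLUB := hK.isStrongLUB_iSup_of_isSuccLimit hδ (S := U) fun i j hij hj => by
    rw [hU ⟨i, hij.trans_lt hj⟩, hU ⟨j, hj⟩]
    exact hS _ _ (e.monotone hij)
  simp only [hU] at hLUB
  have hsup : ⨆ i, S (e i) = ⨆ j, S j := e.toEquiv.iSup_comp (g := S)
  rw [hsup] at hLUB
  exact ⟨fun j => by simpa only [e.apply_symm_apply] using hLUB.strongLE (e.symm j),
    fun T hT => hLUB.least T fun i => hT (e i)⟩

theorem iSup_mem_strong {J : Type w} [LinearOrder J] [WellFoundedLT J] [Nonempty J]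
    {S : J → L.Substructure N} (hmono : Monotone S) (hS : ∀ j, S j ∈ K.strong (asStr L N)) :
    ⨆ j, S j ∈ K.strong (asStr L N) :=
  hK.strongLE_top_iff.1 <| (hK.isStrongLUB_iSup fun i j hij =>
    hK.coherence (asStr L N) _ _ (hS i) (hS j) (hmono hij)).least ⊤ fun j =>
      hK.strongLE_top_iff.2 (hS j)

theorem strong_directLimit_of {J : Type w} [LinearOrder J] [WellFoundedLT J] [Nonempty J]
    {G : J → Type w} [∀ j, L.Structure (G j)] (f : ∀ i j, i ≤ j → G i ↪[L] G j)
    [DirectedSystem G fun i j h => f i j h] (hf : ∀ i j h, K.Strong (f i j h)) (j : J) :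
    K.Strong (Language.DirectLimit.of L J G f j) := by
  let ι : ∀ j, G j ↪[L] Language.DirectLimit G f := Language.DirectLimit.of L J G f
  have hchain : ∀ i j, i ≤ j → K.StrongLE (ι i).toHom.range (ι j).toHom.range := fun i j hij => by
    have hrange : (ι i).toHom.range = (f i j hij).toHom.range.map (ι j).toHom := by
      rw [← Hom.range_comp]
      congr 1
      ext x
      exact DirectLimit.of_f.symm
    rw [hrange, Hom.range_eq_map (ι j).toHom, hK.strongLE_map_iff, hK.strongLE_top_iff]
    exact hf i j hij
  have hLUB := hK.isStrongLUB_iSup hchain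
  rw [show ⨆ j, (ι j).toHom.range = ⊤ from Language.DirectLimit.iSup_range_of_eq_top] at hLUB
  exact hK.strongLE_top_iff.1 (hLUB.strongLE j)

end IsAEC

end AbstractClass

theorem exists_monotone_of_step {P : Type*} [Preorder P] [Nonempty P] {J : Type*} [LinearOrder J]
    [WellFoundedLT J] (Q : (j : J) → (Set.Iio j → P) → P → Prop)
    (hstep : ∀ (j : J) (m : Set.Iio j → P), Monotone m →
      (∀ i : Set.Iio j, Q i (fun k => m ⟨k, lt_trans k.2 i.2⟩) (m i)) →
      ∃ q, (∀ i, m i ≤ q) ∧ Q j m q) :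
    ∃ m : J → P, Monotone m ∧ ∀ j, Q j (fun i => m i) (m j) := by
  classical
  let step : (j : J) → ((i : J) → i < j → P) → P := fun j m =>
    if hq : ∃ q, (∀ i : Set.Iio j, m i i.2 ≤ q) ∧ Q j (fun i => m i i.2) q then hq.choose
    else Classical.arbitrary P
  let m : J → P := (wellFounded_lt (α := J)).fix step
  have hm : ∀ j, m j = step j (fun i _ => m i) := fun j => WellFounded.fix_eq _ _ _
  have hmQ : ∀ j, (∀ i < j, m i ≤ m j) ∧ Q j (fun i => m i) (m j) := fun j => by
    induction j using WellFoundedLT.induction with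
    | ind j IH =>
    have hq : ∃ q, (∀ i : Set.Iio j, m i ≤ q) ∧ Q j (fun i => m i) q := by
      refine hstep j (fun i => m i) (fun i k hik => ?_) fun i => (IH i i.2).2
      rcases (show i.1 ≤ k.1 from hik).eq_or_lt with heq | hlt
      · exact le_of_eq (congrArg m heq)
      · exact (IH k k.2).1 i hlt
    have hmj : m j = hq.choose := (hm j).trans (dif_pos hq)
    rw [hmj]
    exact ⟨fun i hi => hq.choose_spec.1 ⟨i, hi⟩, hq.choose_spec.2⟩
  refine ⟨m, fun i j hij => ?_, fun j => (hmQ j).2⟩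
  rcases hij.eq_or_lt with rfl | hlt
  · exact le_rfl
  · exact (hmQ j).1 i hlt

namespace AbstractClass

open FirstOrder.Language CategoryTheory

variable {L : FirstOrder.Language.{0, 0}} {K : AbstractClass.{w} L}

/-- A member of the class whose elements are labelled by distinct ordinals. The labels make the
strong embeddings that preserve them unique, so that a chain in the preorder given by these
embeddings is a directed system without further choices. -/
structure LabelledModel (hK : K.IsAEC) where
  carrier : Type w
  [str : L.Structure carrier]
  mem : K.Mem carrier
  label : carrier → Ordinal.{w}
  label_injective : Function.Injective label

namespace LabelledModel

variable {hK : K.IsAEC} {p q r : LabelledModel hK}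

attribute [instance] LabelledModel.str

/-- Strong embeddings that preserve the labels. -/
structure IsLabelEmb (p q : LabelledModel hK) (f : p.carrier ↪[L] q.carrier) : Prop where
  strong : K.Strong f
  label_apply : ∀ x, q.label (f x) = p.label x

theorem IsLabelEmb.comp {f : p.carrier ↪[L] q.carrier} {g : q.carrier ↪[L] r.carrier}
    (hg : IsLabelEmb q r g) (hf : IsLabelEmb p q f) : IsLabelEmb p r (g.comp f) :=
  ⟨hK.strong_comp hf.strong hg.strong, fun x => (hg.label_apply _).trans (hf.label_apply x)⟩

theorem IsLabelEmb.unique {f g : p.carrier ↪[L] q.carrier} (hf : IsLabelEmb p q f)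
    (hg : IsLabelEmb p q g) (x : p.carrier) : f x = g x :=
  q.label_injective ((hf.label_apply x).trans (hg.label_apply x).symm)

instance : Preorder (LabelledModel hK) where
  le p q := ∃ f : p.carrier ↪[L] q.carrier, IsLabelEmb p q f
  le_refl p := ⟨Embedding.refl L _, hK.strong_refl p.mem, fun _ => rfl⟩
  le_trans _ _ _ := fun ⟨f, hf⟩ ⟨g, hg⟩ => ⟨g.comp f, hg.comp hf⟩

theorem le_iff : p ≤ q ↔ ∃ f : p.carrier ↪[L] q.carrier, IsLabelEmb p q f := Iff.rfl

theorem IsLabelEmb.range_le {f : p.carrier ↪[L] r.carrier} {g : q.carrier ↪[L] r.carrier}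
    (hf : IsLabelEmb p r f) (hg : IsLabelEmb q r g) (hpq : p ≤ q) :
    f.toHom.range ≤ g.toHom.range := by
  obtain ⟨t, ht⟩ := le_iff.1 hpq
  rintro _ ⟨x, rfl⟩
  exact ⟨t x, (hg.comp ht).unique hf x⟩

theorem exists_label_extension {A B : Type w} {f : A → B} (hf : Function.Injective f)
    {l : A → Ordinal.{w}} (hl : Function.Injective l) :
    ∃ l' : B → Ordinal.{w}, Function.Injective l' ∧ ∀ x, l' (f x) = l x := by
  let s : Ordinal.{w} := Order.succ (⨆ x, l x)
  let e : B → Ordinal.{w} := Ordinal.typein (α := B) WellOrderingRel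
  have hs : ∀ x y, l x < s + e y := fun x y =>
    (Order.lt_succ_of_le (Ordinal.le_iSup l x)).trans_le le_self_add
  let l' : B → Ordinal.{w} := Function.extend f l (fun y => s + e y)
  have hl' : ∀ x, l' (f x) = l x := hf.extend_apply l _
  have hle : ∀ y, (¬∃ x, f x = y) → l' y = s + e y := fun y => Function.extend_apply' _ _ y
  refine ⟨l', fun y z hyz => ?_, hl'⟩
  by_cases hy : ∃ x, f x = y <;> by_cases hz : ∃ x, f x = z
  · obtain ⟨y, rfl⟩ := hy
    obtain ⟨z, rfl⟩ := hz
    rw [hl', hl'] at hyz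
    rw [hl hyz]
  · obtain ⟨y, rfl⟩ := hy
    rw [hl', hle z hz] at hyz
    exact absurd hyz (hs y z).ne
  · obtain ⟨z, rfl⟩ := hz
    rw [hl', hle y hy] at hyz
    exact absurd hyz (hs z y).ne'
  · rw [hle y hy, hle z hz] at hyz
    exact Ordinal.typein_injective _ (add_left_cancel hyz)

/-- A labelling of a member of the class. -/
noncomputable def ofMem (hK : K.IsAEC) {M : Type w} [L.Structure M] (hM : K.Mem M) :
    LabelledModel hK :=
  ⟨M, hM, Ordinal.typein (α := M) WellOrderingRel, Ordinal.typein_injective _⟩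

section Extend

variable (p) {N : Type w} [L.Structure N] {f : p.carrier ↪[L] N} (hf : K.Strong f)

/-- A labelling of a strong extension of `p` that agrees with the one of `p`. -/
noncomputable def extend : LabelledModel hK :=
  let h := exists_label_extension f.injective p.label_injective
  ⟨N, hK.mem_codomain hf, h.choose, h.choose_spec.1⟩

theorem isLabelEmb_extend : IsLabelEmb p (p.extend hf) f :=
  ⟨hf, (exists_label_extension f.injective p.label_injective).choose_spec.2⟩

theorem le_extend : p ≤ p.extend hf :=
  ⟨f, p.isLabelEmb_extend hf⟩

end Extend

theorem exists_label_directLimit {J : Type w} [LinearOrder J] [Nonempty J] {G : J → Type w}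
    [∀ j, L.Structure (G j)] (f : ∀ i j, i ≤ j → G i ↪[L] G j)
    [DirectedSystem G fun i j h => f i j h] (l : ∀ j, G j → Ordinal.{w})
    (hl : ∀ j, Function.Injective (l j)) (hlf : ∀ i j h x, l j (f i j h x) = l i x) :
    ∃ l' : Language.DirectLimit G f → Ordinal.{w}, Function.Injective l' ∧
      ∀ j x, l' (Language.DirectLimit.of L J G f j x) = l j x := by
  let ι : ∀ j, G j ↪[L] Language.DirectLimit G f := Language.DirectLimit.of L J G f
  have hι : ∀ i j h x, ι j (f i j h x) = ι i x := fun i j h x => DirectLimit.of_f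
  have hex : ∀ z : Language.DirectLimit G f, ∃ i x, ι i x = z := Language.DirectLimit.exists_of
  have heq : ∀ i j x y, ι i x = ι j y ↔ l i x = l j y := fun i j x y => by
    obtain ⟨k, hik, hjk⟩ := exists_ge_ge i j
    rw [← hι i k hik, ← hι j k hjk, (ι k).injective.eq_iff, ← (hl k).eq_iff, hlf, hlf]
  choose a b hab using hex
  refine ⟨fun z => l (a z) (b z), fun y z hyz => ?_, fun j x => (heq _ _ _ _).1 (hab _)⟩
  rw [← hab y, ← hab z]
  exact (heq _ _ _ _).2 hyz

theorem exists_limit {J : Type w} [LinearOrder J] [WellFoundedLT J] [Nonempty J]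
    {m : J → LabelledModel hK} (hm : Monotone m) :
    ∃ (q : LabelledModel hK) (ι : ∀ j, (m j).carrier ↪[L] q.carrier),
      (∀ j, IsLabelEmb (m j) q (ι j)) ∧ ⨆ j, (ι j).toHom.range = ⊤ := by
  choose f hf using fun (i j : J) (h : i ≤ j) => le_iff.1 (hm h)
  have hsystem : DirectedSystem (fun j => (m j).carrier) (fun i j h => f i j h) := by
    refine ⟨fun i x => (hf i i _).unique ⟨hK.strong_refl (m i).mem, fun _ => rfl⟩ x,
      fun k j i hij hjk x => ?_⟩
    exact ((hf j k _).comp (hf i j _)).unique (hf i k _) x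
  obtain ⟨l, hl, hlι⟩ := exists_label_directLimit f (fun j => (m j).label)
    (fun j => (m j).label_injective) (fun i j h => (hf i j h).label_apply)
  have hι := hK.strong_directLimit_of f fun i j h => (hf i j h).strong
  exact ⟨⟨_, hK.mem_codomain (hι (Classical.arbitrary J)), l, hl⟩, _, fun j => ⟨hι j, hlι j⟩,
    Language.DirectLimit.iSup_range_of_eq_top⟩

theorem exists_upper_bound {J : Type w} [LinearOrder J] [WellFoundedLT J]
    {m : J → LabelledModel hK} (hm : Monotone m) (hp : ∀ j, p ≤ m j) :
    ∃ q : LabelledModel hK, p ≤ q ∧ ∀ j, m j ≤ q := by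
  rcases isEmpty_or_nonempty J with hJ | hJ
  · exact ⟨p, le_rfl, fun j => hJ.elim j⟩
  · obtain ⟨q, ι, hι, -⟩ := exists_limit hm
    have hq : ∀ j, m j ≤ q := fun j => ⟨ι j, hι j⟩
    exact ⟨q, (hp _).trans (hq (Classical.arbitrary J)), hq⟩

theorem exists_extension_of_requirements {I : Type w} (p : LabelledModel hK)
    (R : I → LabelledModel hK → Prop) (hmono : ∀ i q r, q ≤ r → R i q → R i r)
    (hstep : ∀ i q, p ≤ q → ∃ r, q ≤ r ∧ R i r) :
    ∃ q, p ≤ q ∧ ∀ i, R i q := by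
  obtain ⟨_, _⟩ := exists_wellFoundedLT I
  have : Nonempty (LabelledModel hK) := ⟨p⟩
  obtain ⟨m, hm, hR⟩ := exists_monotone_of_step (J := I) (fun j _ q => p ≤ q ∧ R j q)
    fun j m hm hR => by
      obtain ⟨q, hpq, hq⟩ := exists_upper_bound hm fun i => (hR i).1
      obtain ⟨r, hqr, hr⟩ := hstep j q hpq
      exact ⟨r, fun i => (hq i).trans hqr, hpq.trans hqr, hr⟩
  obtain ⟨q, hpq, hq⟩ := exists_upper_bound hm fun i => (hR i).1
  exact ⟨q, hpq, fun i => hmono i _ _ (hq i) (hR i).2⟩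

end LabelledModel

theorem HasJEP.exists_embed (hJEP : K.HasJEP) {N₁ N₂ : Type w} [L.Structure N₁] [L.Structure N₂]
    (h₁ : K.Mem N₁) (h₂ : K.Mem N₂) :
    ∃ (P : Type w) (_ : L.Structure P) (g₁ : N₁ ↪[L] P) (g₂ : N₂ ↪[L] P),
      K.Strong g₁ ∧ K.Strong g₂ :=
  let ⟨P, g₁, g₂, h⟩ := hJEP (asStr L N₁) (asStr L N₂) h₁ h₂
  ⟨P, P.str, g₁, g₂, h⟩

/-- Every isomorphism between strong submodels of `M`, given as a pair of strong embeddings into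
`M`, extends along `f` to one between strong submodels of `N` containing `M`. -/
def IsBackForth (K : AbstractClass.{w} L) {M N : Type w} [L.Structure M] [L.Structure N]
    (f : M ↪[L] N) : Prop :=
  ∀ (P : Type w) [L.Structure P] (p q : P ↪[L] M), K.Strong p → K.Strong q →
    ∃ (R : Type w) (_ : L.Structure R) (p' q' : R ↪[L] N), K.Strong p' ∧ K.Strong q' ∧
      f.toHom.range ≤ p'.toHom.range ∧ f.toHom.range ≤ q'.toHom.range ∧
      ∀ x, ∃ y, p' y = f (p x) ∧ q' y = f (q x)

namespace IsAEC

variable (hK : K.IsAEC)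
include hK

theorem amalgamate (hAP : K.HasAP) {M N₁ N₂ : Type w} [L.Structure M] [L.Structure N₁]
    [L.Structure N₂] {f₁ : M ↪[L] N₁} {f₂ : M ↪[L] N₂} (h₁ : K.Strong f₁) (h₂ : K.Strong f₂) :
    ∃ (P : Type w) (_ : L.Structure P) (g₁ : N₁ ↪[L] P) (g₂ : N₂ ↪[L] P),
      K.Strong g₁ ∧ K.Strong g₂ ∧ ∀ x, g₁ (f₁ x) = g₂ (f₂ x) :=
  let ⟨P, g₁, g₂, h⟩ :=
    hAP (asStr L M) (asStr L N₁) (asStr L N₂) f₁ f₂ (hK.mem_domain h₁) h₁ h₂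
  ⟨P, P.str, g₁, g₂, h⟩

theorem exists_universal (hJEP : K.HasJEP) (κ : Cardinal.{w}) (p : LabelledModel hK) :
    ∃ q, p ≤ q ∧ ∀ (N : Type w) [L.Structure N], K.Mem N → #N ≤ κ →
      ∃ f : N ↪[L] q.carrier, K.Strong f := by
  obtain ⟨q, hpq, hq⟩ := p.exists_extension_of_requirements
    (fun (i : Σ s : Set κ.out, L.Structure s) q => letI := i.2
      K.Mem i.1 → ∃ f : i.1 ↪[L] q.carrier, K.Strong f)
    (fun ⟨_, _⟩ _ _ ⟨g, hg⟩ h hs =>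
      let ⟨f, hf⟩ := h hs
      ⟨g.comp f, hK.strong_comp hf hg.strong⟩)
    fun ⟨s, _⟩ q _ => by
      by_cases hs : K.Mem s
      · obtain ⟨P, _, g₁, g₂, h₁, h₂⟩ := hJEP.exists_embed q.mem hs
        exact ⟨q.extend h₁, q.le_extend h₁, fun _ => ⟨g₂, h₂⟩⟩
      · exact ⟨q, le_rfl, fun h => absurd h hs⟩
  refine ⟨q, hpq, fun N _ hN hcard => ?_⟩
  obtain ⟨e⟩ : #N ≤ #κ.out := hcard.trans_eq (Cardinal.mk_out κ).symm
  let e' : N ≃ Set.range e := Equiv.ofInjective e e.injective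
  let _ : L.Structure (Set.range e) := e'.inducedStructure
  let E : N ≃[L] Set.range e := e'.inducedStructureEquiv
  obtain ⟨f, hf⟩ := hq ⟨Set.range e, inferInstance⟩ (hK.mem_of_equiv E hN)
  exact ⟨f.comp E.toEmbedding, hK.strong_comp (hK.strong_equiv E hN) hf⟩

theorem exists_forth (hAP : K.HasAP) {M : Type w} [L.Structure M] (hM : K.Mem M) :
    ∃ (N : Type w) (_ : L.Structure N) (f : M ↪[L] N), K.Strong f ∧
      ∀ (P : Type w) [L.Structure P] (p q : P ↪[L] M), K.Strong p → K.Strong q →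
        ∃ g : M ↪[L] N, K.Strong g ∧ ∀ x, g (p x) = f (q x) := by
  let p₀ : LabelledModel hK := .ofMem hK hM
  obtain ⟨N, ⟨f, hf⟩, hN⟩ := p₀.exists_extension_of_requirements
    (fun (i : Σ S : L.Substructure M, S ↪[L] M) N => K.Strong i.1.subtype → K.Strong i.2 →
      ∃ f : p₀.carrier ↪[L] N.carrier, p₀.IsLabelEmb N f ∧
        ∃ g : M ↪[L] N.carrier, K.Strong g ∧ ∀ x : i.1, g x = f (i.2 x))
    (fun _ _ _ ⟨t, ht⟩ h hS he =>
      let ⟨f, hf, g, hg, hgf⟩ := h hS he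
      ⟨t.comp f, ht.comp hf, t.comp g, hK.strong_comp hg ht.strong, fun x => congrArg t (hgf x)⟩)
    fun ⟨S, e⟩ N ⟨i, hi⟩ => by
      by_cases hSe : K.Strong S.subtype ∧ K.Strong e
      · obtain ⟨P, _, g₁, g₂, h₁, h₂, hg⟩ := hK.amalgamate hAP hSe.1
          (f₂ := (i.comp e : S ↪[L] N.carrier)) (hK.strong_comp hSe.2 hi.strong)
        exact ⟨N.extend h₂, N.le_extend h₂, fun _ _ =>
          ⟨g₂.comp i, (N.isLabelEmb_extend h₂).comp hi, g₁, h₁, hg⟩⟩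
      · exact ⟨N, le_rfl, fun hS he => absurd ⟨hS, he⟩ hSe⟩
  refine ⟨N.carrier, inferInstance, f, hf.strong, fun P _ p q hp hq => ?_⟩
  have he : K.Strong p.equivRange.symm.toEmbedding :=
    hK.strong_equiv _ (hK.mem_domain (strong_subtype_iff.2 hp))
  obtain ⟨f', hf', g, hg, hgf⟩ := hN ⟨p.toHom.range, q.comp p.equivRange.symm.toEmbedding⟩
    (strong_subtype_iff.2 hp) (hK.strong_comp he hq)
  refine ⟨g, hg, fun x => (hgf (p.equivRange x)).trans ?_⟩
  exact (hf'.unique hf _).trans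
    (congrArg (fun y => f (q y)) (p.equivRange.symm_apply_apply x))

theorem exists_isBackForth (hAP : K.HasAP) {M : Type w} [L.Structure M] (hM : K.Mem M) :
    ∃ (N : Type w) (_ : L.Structure N) (f : M ↪[L] N), K.Strong f ∧ K.IsBackForth f := by
  obtain ⟨N₁, _, f₁, hf₁, forth₁⟩ := hK.exists_forth hAP hM
  obtain ⟨N₂, _, f₂, hf₂, forth₂⟩ := hK.exists_forth hAP (hK.mem_codomain hf₁)
  refine ⟨N₂, inferInstance, f₂.comp f₁, hK.strong_comp hf₁ hf₂, fun P _ p q hp hq => ?_⟩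
  obtain ⟨g, hg, hgp⟩ := forth₁ P p q hp hq
  obtain ⟨h, hh, hhg⟩ := forth₂ M g f₁ hg hf₁
  refine ⟨N₁, inferInstance, h, f₂, hh, hf₂, ?_, ?_, fun x => ⟨g (p x), hhg _, ?_⟩⟩
  · rintro _ ⟨x, rfl⟩
    exact ⟨g x, hhg x⟩
  · rintro _ ⟨x, rfl⟩
    exact ⟨f₁ x, rfl⟩
  · exact congrArg f₂ (hgp x)

end IsAEC

/-- The isomorphism `P y ↦ Q y` between the ranges of two embeddings. -/
noncomputable def rangePartialEquiv {M R : Type w} [L.Structure M] [L.Structure R]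
    (P Q : R ↪[L] M) : M ≃ₚ[L] M :=
  ⟨P.toHom.range, Q.toHom.range, Q.equivRange.comp P.equivRange.symm⟩

theorem le_rangePartialEquiv {M R : Type w} [L.Structure M] [L.Structure R] {P Q : R ↪[L] M}
    {g : M ≃ₚ[L] M} (h : ∀ x : g.dom, ∃ y, P y = x ∧ Q y = g.toEquiv x) :
    g ≤ rangePartialEquiv P Q := by
  have hle : g.dom ≤ P.toHom.range := fun x hx =>
    let ⟨y, hy, _⟩ := h ⟨x, hx⟩
    ⟨y, hy⟩
  refine ⟨hle, ?_⟩
  ext x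
  obtain ⟨y, hPy, hQy⟩ := h x
  have hy : P.equivRange.symm (Substructure.inclusion hle x) = y := by
    rw [show Substructure.inclusion hle x = P.equivRange y from Subtype.ext hPy.symm]
    exact P.equivRange.symm_apply_apply y
  exact (congrArg Q hy).trans hQy

/-- Isomorphisms between strong submodels of `M`. -/
structure IsStrongPartialEquiv (K : AbstractClass.{w} L) {M : Type w} [L.Structure M]
    (g : M ≃ₚ[L] M) : Prop where
  dom : g.dom ∈ K.strong (asStr L M)
  cod : g.cod ∈ K.strong (asStr L M)

/-- The back-and-forth property inside a single model `M`: isomorphisms between strong submodels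
of `E` extend to ones between strong submodels of `D` containing `E`. -/
def IsBackForthPair (K : AbstractClass.{w} L) {M : Type w} [L.Structure M]
    (E D : L.Substructure M) : Prop :=
  ∀ g : M ≃ₚ[L] M, K.IsStrongPartialEquiv g → g.dom ≤ E → g.cod ≤ E →
    ∃ g', g ≤ g' ∧ K.IsStrongPartialEquiv g' ∧ g'.dom ∈ Set.Icc E D ∧ g'.cod ∈ Set.Icc E D

/-- A filtration of `M` by back-and-forth pairs, each contained in the following ones. -/
structure IsBackForthFiltration (K : AbstractClass.{w} L) {J : Type w} [LinearOrder J]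
    {M : Type w} [L.Structure M] (E D : J → L.Substructure M) : Prop where
  le : ∀ j, E j ≤ D j
  le_of_lt : ∀ i j, i < j → D i ≤ E j
  iSup_eq_top : ⨆ j, D j = ⊤
  backForth : ∀ j, K.IsBackForthPair (E j) (D j)

namespace IsAEC

variable (hK : K.IsAEC)
include hK

theorem exists_strong_lift {M A : Type w} [L.Structure M] [L.Structure A] {u : A ↪[L] M}
    (hu : K.Strong u) {S : L.Substructure M} (hS : S ∈ K.strong (asStr L M))
    (hle : S ≤ u.toHom.range) : ∃ p : S ↪[L] A, K.Strong p ∧ ∀ x, u (p x) = x := by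
  let p : S ↪[L] A := u.equivRange.symm.toEmbedding.comp (Substructure.inclusion hle)
  have hp : ∀ x, u (p x) = x := fun x =>
    congrArg Subtype.val (u.equivRange.apply_symm_apply (Substructure.inclusion hle x))
  exact ⟨p, hK.strong_of_comp (g := u)
    (strong_congr (fun x => (hp x).symm) (strong_subtype_iff.2 hS)) hu, hp⟩

theorem isBackForthPair_range {M A B : Type w} [L.Structure M] [L.Structure A] [L.Structure B]
    {f : A ↪[L] B} {v : B ↪[L] M} (hf : K.Strong f) (hbf : K.IsBackForth f) (hv : K.Strong v) :
    K.IsBackForthPair (v.comp f).toHom.range v.toHom.range := by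
  intro g hg hdom hcod
  obtain ⟨p, hp, hvp⟩ := hK.exists_strong_lift (hK.strong_comp hf hv) hg.dom hdom
  obtain ⟨q, hq, hvq⟩ := hK.exists_strong_lift (hK.strong_comp hf hv) hg.cod hcod
  have hgequiv : K.Strong g.toEquiv.toEmbedding :=
    hK.strong_equiv _ (hK.mem_domain (strong_subtype_iff.2 hg.dom))
  obtain ⟨R, _, p', q', hp', hq', hfp, hfq, hpq⟩ :=
    hbf g.dom p (q.comp g.toEquiv.toEmbedding) hp (hK.strong_comp hgequiv hq)
  have hle : g ≤ rangePartialEquiv (v.comp p') (v.comp q') :=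
    le_rangePartialEquiv fun x =>
      let ⟨y, hpy, hqy⟩ := hpq x
      ⟨y, (congrArg v hpy).trans (hvp x), (congrArg v hqy).trans (hvq _)⟩
  have hrange : ∀ r : R ↪[L] B, f.toHom.range ≤ r.toHom.range →
      (v.comp r).toHom.range ∈ Set.Icc (v.comp f).toHom.range v.toHom.range := fun r hr => by
    constructor <;> rintro _ ⟨x, rfl⟩
    · obtain ⟨y, hy⟩ := hr ⟨x, rfl⟩
      exact ⟨y, congrArg v hy⟩
    · exact ⟨r x, rfl⟩
  exact ⟨_, hle, ⟨hK.strong_comp hp' hv, hK.strong_comp hq' hv⟩, hrange p' hfp, hrange q' hfq⟩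

theorem exists_isBackForthFiltration (hAP : K.HasAP) (p₀ : LabelledModel hK) (J : Type w)
    [LinearOrder J] [WellFoundedLT J] [Nonempty J] :
    ∃ q, p₀ ≤ q ∧ ∃ E D : J → L.Substructure q.carrier, K.IsBackForthFiltration E D := by
  have : Nonempty (LabelledModel hK) := ⟨p₀⟩
  obtain ⟨m, hm, hQ⟩ := exists_monotone_of_step (P := LabelledModel hK) (J := J)
    (fun j m q => p₀ ≤ q ∧ ∃ p : LabelledModel hK, (∀ i, m i ≤ p) ∧
      ∃ f : p.carrier ↪[L] q.carrier, p.IsLabelEmb q f ∧ K.IsBackForth f)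
    fun j m hm hQ => by
      obtain ⟨p, hp₀, hp⟩ := LabelledModel.exists_upper_bound hm fun i => (hQ i).1
      obtain ⟨N, _, f, hf, hbf⟩ := hK.exists_isBackForth hAP p.mem
      have hle := p.le_extend hf
      exact ⟨p.extend hf, fun i => (hp i).trans hle, hp₀.trans hle, p, hp, f,
        p.isLabelEmb_extend hf, hbf⟩
  choose hp₀ p hp f hf hbf using hQ
  obtain ⟨q, v, hv, htop⟩ := LabelledModel.exists_limit hm
  let j₀ : J := Classical.arbitrary J
  refine ⟨q, (hp₀ j₀).trans ⟨v j₀, hv j₀⟩, fun j => ((v j).comp (f j)).toHom.range,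
    fun j => (v j).toHom.range, fun j => ?_, fun i j hij => ?_, htop,
    fun j => hK.isBackForthPair_range (hf j).strong (hbf j) (hv j).strong⟩
  · exact ((hv j).comp (hf j)).range_le (hv j) ⟨f j, hf j⟩
  · exact (hv i).range_le ((hv j).comp (hf j)) (hp j ⟨i, hij⟩)

theorem isStrongPartialEquiv_limit {M : Type w} [L.Structure M] {J : Type w} [LinearOrder J]
    [WellFoundedLT J] [Nonempty J] {F : J →o (M ≃ₚ[L] M)}
    (hF : ∀ j, K.IsStrongPartialEquiv (F j)) :
    K.IsStrongPartialEquiv (Language.DirectLimit.partialEquivLimit F) :=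
  ⟨hK.iSup_mem_strong (PartialEquiv.monotone_dom.comp F.monotone) fun j => (hF j).dom,
    hK.iSup_mem_strong (PartialEquiv.monotone_cod.comp F.monotone) fun j => (hF j).cod⟩

theorem exists_partialEquiv_upper_bound {M : Type w} [L.Structure M] {J : Type w} [LinearOrder J]
    [WellFoundedLT J] {E : L.Substructure M} {g₀ : M ≃ₚ[L] M} (hg₀ : K.IsStrongPartialEquiv g₀)
    (hdom₀ : g₀.dom ≤ E) (hcod₀ : g₀.cod ≤ E) {m : J → (M ≃ₚ[L] M)} (hmono : Monotone m)
    (hm : ∀ j, K.IsStrongPartialEquiv (m j)) (hle : ∀ j, g₀ ≤ m j) (hdom : ∀ j, (m j).dom ≤ E)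
    (hcod : ∀ j, (m j).cod ≤ E) :
    ∃ g : M ≃ₚ[L] M, (∀ j, m j ≤ g) ∧ g₀ ≤ g ∧ K.IsStrongPartialEquiv g ∧ g.dom ≤ E ∧
      g.cod ≤ E := by
  rcases isEmpty_or_nonempty J with hJ | hJ
  · exact ⟨g₀, fun j => hJ.elim j, le_rfl, hg₀, hdom₀, hcod₀⟩
  · let F : J →o (M ≃ₚ[L] M) := ⟨m, hmono⟩
    have hF := Language.DirectLimit.le_partialEquivLimit F
    exact ⟨_, hF, (hle _).trans (hF (Classical.arbitrary J)),
      hK.isStrongPartialEquiv_limit (F := F) hm, iSup_le hdom, iSup_le hcod⟩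

end IsAEC

namespace IsBackForthFiltration

variable {J : Type w} [LinearOrder J] {M : Type w} [L.Structure M] {E D : J → L.Substructure M}
  (h : K.IsBackForthFiltration E D)
include h

theorem monotone : Monotone D := fun i j hij => by
  rcases hij.eq_or_lt with rfl | hlt
  · exact le_rfl
  · exact (h.le_of_lt i j hlt).trans (h.le j)

theorem restrict_Ioi [NoMaxOrder J] (j₀ : J) :
    K.IsBackForthFiltration (fun j : Set.Ioi j₀ => E j) (fun j => D j) := by
  refine ⟨fun j => h.le j, fun i j => h.le_of_lt i j, ?_, fun j => h.backForth j⟩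
  rw [eq_top_iff, ← h.iSup_eq_top]
  refine iSup_le fun i => ?_
  obtain ⟨k, hk⟩ := exists_gt (max i j₀)
  exact (h.monotone ((le_max_left _ _).trans hk.le)).trans
    (le_iSup (fun j : Set.Ioi j₀ => D j) ⟨k, (le_max_right _ _).trans_lt hk⟩)

theorem iSup_eq_top_of_le [NoMaxOrder J] {U : J → L.Substructure M} (hU : ∀ j, E j ≤ U j) :
    ⨆ j, U j = ⊤ := by
  rw [eq_top_iff, ← h.iSup_eq_top]
  refine iSup_le fun i => ?_
  obtain ⟨k, hk⟩ := exists_gt i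
  exact (h.le_of_lt i k hk).trans ((hU k).trans (le_iSup U k))

theorem exists_le [Nonempty J] {S : L.Substructure M} (hS : #S < Order.cof J) :
    ∃ j, S ≤ D j := by
  have hmem : ∀ x : S, ∃ j, (x : M) ∈ D j := fun x =>
    (Substructure.mem_iSup_of_directed h.monotone.directed_le).1
      (h.iSup_eq_top.symm ▸ Substructure.mem_top (x : M))
  choose a ha using hmem
  have hbounded : ¬ IsCofinal (Set.range a) := fun hcof =>
    ((Order.cof_le hcof).trans Cardinal.mk_range_le).not_gt hS
  obtain ⟨j, hj⟩ := not_isCofinal_iff.1 hbounded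
  exact ⟨j, fun x hx => h.monotone (hj _ ⟨⟨x, hx⟩, rfl⟩).le (ha ⟨x, hx⟩)⟩

variable [WellFoundedLT J] [NoMaxOrder J]

theorem exists_equiv_extension [Nonempty J] (hK : K.IsAEC) {g₀ : M ≃ₚ[L] M}
    (hg₀ : K.IsStrongPartialEquiv g₀) (hdom₀ : ∀ j, g₀.dom ≤ E j) (hcod₀ : ∀ j, g₀.cod ≤ E j) :
    ∃ π : M ≃[L] M, ∀ x : g₀.dom, π x = g₀.toEquiv x := by
  have : Nonempty (M ≃ₚ[L] M) := ⟨g₀⟩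
  obtain ⟨m, hm, hQ⟩ := exists_monotone_of_step (P := M ≃ₚ[L] M) (J := J)
    (fun j _ g => g₀ ≤ g ∧ K.IsStrongPartialEquiv g ∧ g.dom ∈ Set.Icc (E j) (D j) ∧
      g.cod ∈ Set.Icc (E j) (D j))
    fun j m hm hQ => by
      obtain ⟨g, hmg, hg₀g, hg, hdom, hcod⟩ := hK.exists_partialEquiv_upper_bound hg₀ (hdom₀ j)
        (hcod₀ j) hm (fun i => (hQ i).2.1) (fun i => (hQ i).1)
        (fun i => (hQ i).2.2.1.2.trans (h.le_of_lt i j i.2))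
        (fun i => (hQ i).2.2.2.2.trans (h.le_of_lt i j i.2))
      obtain ⟨g', hgg', hg'⟩ := h.backForth j g hg hdom hcod
      exact ⟨g', fun i => (hmg i).trans hgg', hg₀g.trans hgg', hg'⟩
  let F : J →o (M ≃ₚ[L] M) := ⟨m, hm⟩
  let g := Language.DirectLimit.partialEquivLimit F
  have hdom : g.dom = ⊤ := h.iSup_eq_top_of_le fun j => (hQ j).2.2.1.1
  have hcod : g.cod = ⊤ := h.iSup_eq_top_of_le fun j => (hQ j).2.2.2.1
  obtain ⟨hle, hg⟩ : g₀ ≤ g :=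
    (hQ (Classical.arbitrary J)).1.trans (Language.DirectLimit.le_partialEquivLimit F _)
  refine ⟨PartialEquiv.toEquivOfEqTop hdom hcod, fun x => ?_⟩
  have hπ := DFunLike.congr_fun (PartialEquiv.toEquivOfEqTop_toEmbedding hdom hcod) (x : M)
  rw [PartialEquiv.toEmbeddingOfEqTop_apply] at hπ
  exact hπ.trans (DFunLike.congr_fun hg x)

theorem exists_equiv_extension_of_mk_lt [Nonempty J] (hK : K.IsAEC) {g₀ : M ≃ₚ[L] M}
    (hg₀ : K.IsStrongPartialEquiv g₀) (hdom : #g₀.dom < Order.cof J)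
    (hcod : #g₀.cod < Order.cof J) : ∃ π : M ≃[L] M, ∀ x : g₀.dom, π x = g₀.toEquiv x := by
  obtain ⟨j₁, h₁⟩ := h.exists_le hdom
  obtain ⟨j₂, h₂⟩ := h.exists_le hcod
  let j₀ := max j₁ j₂
  have : Nonempty (Set.Ioi j₀) := let ⟨j, hj⟩ := exists_gt j₀; ⟨⟨j, hj⟩⟩
  exact (h.restrict_Ioi j₀).exists_equiv_extension hK hg₀
    (fun j => h₁.trans (h.le_of_lt _ _ ((le_max_left _ _).trans_lt j.2)))
    (fun j => h₂.trans (h.le_of_lt _ _ ((le_max_right _ _).trans_lt j.2)))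

end IsBackForthFiltration

theorem IsAEC.exists_isMonster (hK : K.IsAEC) (hAP : K.HasAP) (hJEP : K.HasJEP)
    {κ : Cardinal.{w}} (hκ : κ.IsRegular) {M₀ : Type w} [L.Structure M₀] (hM₀ : K.Mem M₀) :
    ∃ (M : Type w) (_ : L.Structure M), K.IsMonster κ (asStr L M) := by
  let J : Type w := κ.ord.ToType
  have : NoMaxOrder J := Cardinal.noMaxOrder hκ.1
  have : Nonempty J :=
    Ordinal.nonempty_toType_iff.2 (Cardinal.ord_pos.2 (Cardinal.aleph0_pos.trans_le hκ.1)).ne'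
  have hcof : Order.cof J = κ := (Ordinal.cof_toType _).trans hκ.cof_ord
  obtain ⟨p, -, huniv⟩ := hK.exists_universal hJEP κ (.ofMem hK hM₀)
  obtain ⟨q, ⟨f, hf⟩, E, D, hED⟩ := hK.exists_isBackForthFiltration hAP p J
  refine ⟨q.carrier, inferInstance, q.mem, fun N hN hcard => ?_, fun S hS T hT hSκ hTκ e => ?_⟩
  · obtain ⟨g, hg⟩ := huniv N hN hcard
    exact ⟨f.comp g, hK.strong_comp hg hf.strong⟩
  · exact hED.exists_equiv_extension_of_mk_lt hK (g₀ := ⟨S, T, e⟩) ⟨hS, hT⟩ (hSκ.trans_eq hcof.symm)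
      (hTκ.trans_eq hcof.symm)

/-- The Galois type over `M` of an element `x` of a strong extension `m` of `M`. -/
def galoisType {M N : Type w} [L.Structure M] [L.Structure N] {m : M ↪[L] N} (hm : K.Strong m)
    (x : N) : K.GaloisType (asStr L M) :=
  Quot.mk _ ⟨asStr L N, m, hm, x⟩

theorem IsMonster.exists_automorphism {κ : Cardinal.{w}} {N Q : Type w} [L.Structure N]
    [L.Structure Q] (hN : K.IsMonster κ (asStr L N)) (hQ : #Q < κ) {k₁ k₂ : Q ↪[L] N}
    (hk₁ : K.Strong k₁) (hk₂ : K.Strong k₂) : ∃ f : N ≃[L] N, ∀ y, f (k₁ y) = k₂ y := by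
  have hcard : ∀ j : Q ↪[L] N, #j.toHom.range < κ := fun j => by
    rwa [← Cardinal.mk_congr j.equivRange.toEquiv]
  let e : k₁.toHom.range ≃[L] k₂.toHom.range := k₂.equivRange.comp k₁.equivRange.symm
  obtain ⟨f, hf⟩ := hN.homogeneous k₁.toHom.range hk₁ k₂.toHom.range hk₂ (hcard k₁) (hcard k₂) e
  have he : ∀ y, e (k₁.equivRange y) = k₂.equivRange y := fun y =>
    congrArg k₂.equivRange (k₁.equivRange.symm_apply_apply y)
  exact ⟨f, fun y => (hf (k₁.equivRange y)).trans (congrArg Subtype.val (he y))⟩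

namespace IsAEC

variable (hK : K.IsAEC)
include hK

theorem rel_equivalence (hAP : K.HasAP) (M : Bundled.{w} L.Structure) :
    Equivalence (PreType.Rel (K := K) (M := M)) where
  refl p :=
    have hid := hK.strong_refl (hK.mem_codomain p.isStrong)
    ⟨p.ext, Embedding.refl L _, Embedding.refl L _, hid, hid, fun _ => rfl, rfl⟩
  symm := fun ⟨P, g, h, hg, hh, hM, helt⟩ => ⟨P, h, g, hh, hg, fun x => (hM x).symm, helt.symm⟩
  trans := by
    rintro p q r ⟨P, g, h, hg, hh, hM, helt⟩ ⟨P', g', h', hg', hh', hM', helt'⟩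
    obtain ⟨R, _, s, t, hs, ht, hst⟩ := hK.amalgamate hAP hh hg'
    refine ⟨Bundled.of R, s.comp g, t.comp h', hK.strong_comp hg hs, hK.strong_comp hh' ht,
      fun x => ?_, ?_⟩
    · exact (congrArg s (hM x)).trans ((hst _).trans (congrArg t (hM' x)))
    · exact (congrArg s helt).trans ((hst _).trans (congrArg t helt'))

variable {M M₁ M₂ : Type w} [L.Structure M] [L.Structure M₁] [L.Structure M₂]
  {m₁ : M ↪[L] M₁} {m₂ : M ↪[L] M₂} {hm₁ : K.Strong m₁} {hm₂ : K.Strong m₂} {x₁ : M₁} {x₂ : M₂}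

theorem exists_amalgam_of_galoisType_eq (hAP : K.HasAP)
    (htype : galoisType hm₁ x₁ = galoisType hm₂ x₂) :
    ∃ (P : Type w) (_ : L.Structure P) (g : M₁ ↪[L] P) (h : M₂ ↪[L] P), K.Strong g ∧ K.Strong h ∧
      (∀ x, g (m₁ x) = h (m₂ x)) ∧ g x₁ = h x₂ := by
  obtain ⟨P, g, h, hgh⟩ := (hK.rel_equivalence hAP _).eqvGen_iff.1 (Quot.eqvGen_exact htype)
  exact ⟨P, P.str, g, h, hgh⟩

theorem exists_extension_of_galoisType_eq (hAP : K.HasAP)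
    (htype : galoisType hm₁ x₁ = galoisType hm₂ x₂) {Q : Type w} [L.Structure Q]
    {i₁ : M₁ ↪[L] Q} {i₂ : M₂ ↪[L] Q} (hi₁ : K.Strong i₁) (hi₂ : K.Strong i₂) :
    ∃ (P : Type w) (_ : L.Structure P) (k₁ k₂ : Q ↪[L] P), K.Strong k₁ ∧ K.Strong k₂ ∧
      (∀ x, k₁ (i₁ (m₁ x)) = k₂ (i₂ (m₂ x))) ∧ k₁ (i₁ x₁) = k₂ (i₂ x₂) := by
  obtain ⟨R, _, g, h, hg, hh, hM, helt⟩ := hK.exists_amalgam_of_galoisType_eq hAP htype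
  obtain ⟨R₁, _, r, s, hr, hs, hrs⟩ := hK.amalgamate hAP hi₁ hg
  obtain ⟨P, _, t, k₂, ht, hk₂, htk⟩ := hK.amalgamate hAP (hK.strong_comp hh hs) hi₂
  have hglue : ∀ y₁ y₂, g y₁ = h y₂ → t (r (i₁ y₁)) = k₂ (i₂ y₂) := fun y₁ y₂ hy =>
    (congrArg t ((hrs y₁).trans (congrArg s hy))).trans (htk y₂)
  exact ⟨P, inferInstance, t.comp r, k₂, hK.strong_comp hr ht, hk₂,
    fun x => hglue _ _ (hM x), hglue _ _ helt⟩

theorem exists_monster_automorphism (hAP : K.HasAP) (hJEP : K.HasJEP)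
    (htype : galoisType hm₁ x₁ = galoisType hm₂ x₂) {Q : Type w} [L.Structure Q]
    {i₁ : M₁ ↪[L] Q} {i₂ : M₂ ↪[L] Q} (hi₁ : K.Strong i₁) (hi₂ : K.Strong i₂)
    (hi : ∀ x, i₁ (m₁ x) = i₂ (m₂ x)) (κ₀ : Cardinal.{w}) :
    ∃ κ, κ₀ ≤ κ ∧ ∃ (N : Type w) (_ : L.Structure N) (k : Q ↪[L] N) (f : N ≃[L] N),
      K.IsMonster κ (asStr L N) ∧ K.Strong k ∧ (∀ x, f (k (i₁ (m₁ x))) = k (i₁ (m₁ x))) ∧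
      f (k (i₂ x₂)) = k (i₁ x₁) := by
  obtain ⟨P, _, k₁, k₂, hk₁, hk₂, hM, helt⟩ :=
    hK.exists_extension_of_galoisType_eq hAP htype hi₁ hi₂
  let κ := Order.succ (max κ₀ (max #P ℵ₀))
  have hκ : κ.IsRegular := Cardinal.isRegular_succ ((le_max_right _ _).trans (le_max_right _ _))
  have hκP : #P < κ := Order.lt_succ_of_le ((le_max_left _ _).trans (le_max_right _ _))
  have hP : K.Mem P := hK.mem_codomain hk₁
  obtain ⟨N, _, hN⟩ := hK.exists_isMonster hAP hJEP hκ hP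
  obtain ⟨k, hk⟩ : ∃ k : P ↪[L] N, K.Strong k := hN.universal (asStr L P) hP hκP.le
  obtain ⟨f, hf⟩ := hN.exists_automorphism
    ((Cardinal.mk_le_of_injective k₁.injective).trans_lt hκP) (hK.strong_comp hk₁ hk)
    (hK.strong_comp hk₂ hk)
  have hf₂ : ∀ y₁ y₂, k₁ (i₁ y₁) = k₂ (i₂ y₂) → f (k (k₂ (i₂ y₂))) = k (k₂ (i₁ y₁)) :=
    fun y₁ y₂ hy => (congrArg (fun z => f (k z)) hy.symm).trans (hf _)
  refine ⟨κ, (le_max_left _ _).trans (Order.le_succ _), N, inferInstance, k.comp k₂, f, hN,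
    hK.strong_comp hk₂ hk, fun x => ?_, hf₂ _ _ helt⟩
  exact (congrArg (fun z => f (k (k₂ z))) (hi x)).trans (hf₂ _ _ (hM x))

end IsAEC

end AbstractClass

section Closure

variable {ι G : Type*} [Group G]

theorem exists_finset_mem_closure {c : ι → G} {x : G}
    (hx : x ∈ Subgroup.closure (Set.range c)) :
    ∃ s : Finset ι, x ∈ Subgroup.closure (c '' s) := by
  classical
  have mono {s t : Finset ι} (h : s ⊆ t) : Subgroup.closure (c '' s) ≤ Subgroup.closure (c '' t) :=
    Subgroup.closure_mono (Set.image_mono (Finset.coe_subset.2 h))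
  induction hx using Subgroup.closure_induction with
  | mem x hx =>
    obtain ⟨i, rfl⟩ := hx
    exact ⟨{i}, Subgroup.subset_closure ⟨i, by simp, rfl⟩⟩
  | one => exact ⟨∅, one_mem _⟩
  | mul x y _ _ hx hy =>
    obtain ⟨s, hs⟩ := hx
    obtain ⟨t, ht⟩ := hy
    exact ⟨s ∪ t, mul_mem (mono Finset.subset_union_left hs) (mono Finset.subset_union_right ht)⟩
  | inv x _ hx =>
    obtain ⟨s, hs⟩ := hx
    exact ⟨s, inv_mem hs⟩

theorem closure_range_codRestrict (c : ι → G) {S : Subgroup G}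
    (hS : Subgroup.closure (Set.range c) = S) (hc : ∀ i, c i ∈ S) :
    Subgroup.closure (Set.range fun i => (⟨c i, hc i⟩ : S)) = ⊤ := by
  apply Subgroup.map_injective S.subtype_injective
  rw [MonoidHom.map_closure, ← Set.range_comp, ← MonoidHom.range_eq_map, S.range_subtype]
  exact hS

end Closure

section Variety

variable {W : Set (FreeGroup ℕ)}

theorem map_freeGroup_lift {ι : Type*} {G H : Type*} [Group G] [Group H] (φ : G →* H) (v : ι → G)
    (r : FreeGroup ι) : φ (FreeGroup.lift v r) = FreeGroup.lift (fun i => φ (v i)) r := by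
  have : φ.comp (FreeGroup.lift v) = FreeGroup.lift (fun i => φ (v i)) := by
    ext i
    simp
  exact DFunLike.congr_fun this r

theorem InVariety.of_injective {G : Type u} {H : Type w} [Group G] [Group H] (hG : InVariety W G)
    (φ : H →* G) (hφ : Function.Injective φ) : InVariety W H := by
  intro r hr v
  apply hφ
  rw [map_freeGroup_lift, hG r hr, map_one]

theorem InVariety.subgroup {G : Type u} [Group G] (hG : InVariety W G) (A : Subgroup G) :
    InVariety W A :=
  hG.of_injective A.subtype A.subtype_injective

variable (W) in
/-- The verbal subgroup of a free group: the normal closure of the values of the laws. -/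
def verbalSubgroup (ι : Type u) : Subgroup (FreeGroup ι) :=
  Subgroup.normalClosure {x | ∃ r ∈ W, ∃ v : ℕ → FreeGroup ι, x = FreeGroup.lift v r}

instance (ι : Type u) : (verbalSubgroup W ι).Normal := Subgroup.normalClosure_normal

variable (W) in
/-- The variety contains a nontrivial group, so that free bases are injective families. -/
def IsNontrivialVariety : Prop := ∃ (G : Type u) (_ : Group G), InVariety W G ∧ Nontrivial G

variable (W) in
/-- The free object of the variety on a type of generators, as a relatively free group. -/
abbrev VFree (ι : Type u) : Type u := FreeGroup ι ⧸ verbalSubgroup W ι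

variable (W) in
/-- The canonical generators of the free object of the variety. -/
def VFree.of {ι : Type u} (i : ι) : VFree W ι := QuotientGroup.mk' _ (FreeGroup.of i)

theorem inVariety_vfree (ι : Type u) : InVariety W (VFree W ι) := by
  intro r hr v
  choose v' hv' using fun i => QuotientGroup.mk'_surjective (verbalSubgroup W ι) (v i)
  obtain rfl : (fun i => QuotientGroup.mk' _ (v' i)) = v := funext hv'
  rw [← map_freeGroup_lift]
  exact (QuotientGroup.eq_one_iff _).2 (Subgroup.subset_normalClosure ⟨r, hr, v', rfl⟩)

theorem isFreeBasis_vfree_of (ι : Type u) : IsFreeBasis W (VFree.of W : ι → VFree W ι) := by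
  refine ⟨inVariety_vfree ι, fun H _ hH f => ?_⟩
  have hle : verbalSubgroup W ι ≤ (FreeGroup.lift f).ker := by
    apply Subgroup.normalClosure_le_normal
    rintro _ ⟨r, hr, v, rfl⟩
    change FreeGroup.lift f _ = 1
    rw [map_freeGroup_lift, hH r hr]
  refine ⟨QuotientGroup.lift _ (FreeGroup.lift f) hle, fun i => ?_, fun ψ hψ => ?_⟩
  · change FreeGroup.lift f (FreeGroup.of i) = f i
    simp
  · apply QuotientGroup.monoidHom_ext
    ext i
    exact (hψ i).trans (by simp)

namespace IsFreeBasis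

variable {ι : Type w} {G : Type u} [Group G] {b : ι → G}

/-- The homomorphism with prescribed values on a free basis. -/
noncomputable def lift (hb : IsFreeBasis W b) {H : Type u} [Group H] (hH : InVariety W H)
    (f : ι → H) : G →* H :=
  (hb.2 H hH f).choose

@[simp]
theorem lift_apply (hb : IsFreeBasis W b) {H : Type u} [Group H] (hH : InVariety W H)
    (f : ι → H) (i : ι) : hb.lift hH f (b i) = f i :=
  (hb.2 H hH f).choose_spec.1 i

theorem hom_ext (hb : IsFreeBasis W b) {H : Type u} [Group H] (hH : InVariety W H)
    {φ ψ : G →* H} (h : ∀ i, φ (b i) = ψ (b i)) : φ = ψ :=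
  (hb.2 H hH fun i => ψ (b i)).unique h fun _ => rfl

theorem closure_range (hb : IsFreeBasis W b) : Subgroup.closure (Set.range b) = ⊤ := by
  rw [eq_top_iff]
  intro g _
  let S := Subgroup.closure (Set.range b)
  let φ : G →* S := hb.lift (hb.1.subgroup S) fun i => ⟨b i, Subgroup.subset_closure ⟨i, rfl⟩⟩
  have hφ : S.subtype.comp φ = MonoidHom.id G := hb.hom_ext hb.1 fun i => by simp [φ]
  have hg : ((φ g : S) : G) = g := DFunLike.congr_fun hφ g
  exact hg ▸ (φ g).2

theorem of_closure (hG : InVariety W G) (hb : Subgroup.closure (Set.range b) = ⊤)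
    (h : ∀ (H : Type u) [Group H], InVariety W H → ∀ f : ι → H, ∃ φ : G →* H, ∀ i, φ (b i) = f i) :
    IsFreeBasis W b := by
  refine ⟨hG, fun H _ hH f => ?_⟩
  obtain ⟨φ, hφ⟩ := h H hH f
  refine ⟨φ, hφ, fun ψ hψ => MonoidHom.eq_of_eqOn_dense hb ?_⟩
  rintro _ ⟨i, rfl⟩
  rw [hφ, hψ]

theorem reindex (hb : IsFreeBasis W b) {κ : Type*} (e : κ ≃ ι) :
    IsFreeBasis W (fun k => b (e k)) := by
  refine of_closure hb.1 ?_ fun H _ hH f => ⟨hb.lift hH fun i => f (e.symm i), fun k => by simp⟩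
  rw [← hb.closure_range]
  congr 1
  exact e.surjective.range_comp b

theorem reindex_bijective (hb : IsFreeBasis W b) {κ : Type*} {c : κ → G} (τ : κ → ι)
    (hτ : Function.Bijective τ) (hc : ∀ k, b (τ k) = c k) : IsFreeBasis W c :=
  funext hc ▸ hb.reindex (Equiv.ofBijective τ hτ)

theorem notMem_closure_image (hb : IsFreeBasis W b)
    (hW : IsNontrivialVariety.{u} W) {s : Set ι} {i : ι}
    (hi : i ∉ s) : b i ∉ Subgroup.closure (b '' s) := by
  classical
  obtain ⟨H, _, hH, _⟩ := hW
  obtain ⟨h, hh⟩ := exists_ne (1 : H)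
  let φ : G →* H := hb.lift hH (Pi.mulSingle i h)
  have hker : Subgroup.closure (b '' s) ≤ φ.ker := by
    rw [Subgroup.closure_le]
    rintro _ ⟨j, hj, rfl⟩
    have hji : j ≠ i := fun hji => hi (hji ▸ hj)
    simp [φ, hji]
  intro hmem
  have hφ : φ (b i) = h := by simp [φ]
  exact hh (hφ.symm.trans (hker hmem))

theorem injective (hb : IsFreeBasis W b)
    (hW : IsNontrivialVariety.{u} W) : Function.Injective b := by
  intro i j hij
  by_contra hne
  have hi : i ∉ ({j} : Set ι) := hne
  exact hb.notMem_closure_image hW hi (Subgroup.subset_closure ⟨j, rfl, hij.symm⟩)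

theorem subtype_range (hb : IsFreeBasis W b) (hinj : Function.Injective b) :
    IsFreeBasis W (fun x : Set.range b => (x : G)) :=
  hb.reindex_bijective (Equiv.ofInjective b hinj).symm (Equiv.ofInjective b hinj).symm.bijective
    (Equiv.apply_ofInjective_symm hinj)

theorem isFree (hb : IsFreeBasis W b) (hinj : Function.Injective b) : IsFree W G :=
  ⟨Set.range b, hb.subtype_range hinj⟩

theorem isFreeInf [Infinite ι] (hb : IsFreeBasis W b) (hinj : Function.Injective b) :
    IsFreeInf W G :=
  ⟨Set.range b, Set.infinite_range_of_injective hinj, hb.subtype_range hinj⟩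

theorem restrict (hb : IsFreeBasis W b) (s : Set ι) :
    IsFreeBasis W (fun i : s => (⟨b i, Subgroup.subset_closure ⟨i, i.2, rfl⟩⟩ :
      Subgroup.closure (b '' s))) := by
  classical
  refine of_closure (hb.1.subgroup _) ?_ fun H _ hH f =>
    ⟨(hb.lift hH fun i => if h : i ∈ s then f ⟨i, h⟩ else 1).comp (Subgroup.subtype _),
      fun i => by simp⟩
  exact closure_range_codRestrict (fun i : s => b i) (by rw [Set.image_eq_range]) _

theorem isFreeProduct (hb : IsFreeBasis W b) (s : Set ι) :
    IsFreeProduct W (Subgroup.closure (b '' s)).subtype (Subgroup.closure (b '' sᶜ)).subtype := by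
  classical
  refine ⟨hb.1, fun H _ hH f g => ?_⟩
  refine ⟨hb.lift hH fun i => if h : i ∈ s then f ⟨b i, Subgroup.subset_closure ⟨i, h, rfl⟩⟩
    else g ⟨b i, Subgroup.subset_closure ⟨i, h, rfl⟩⟩, ⟨?_, ?_⟩, ?_⟩
  · exact (hb.restrict s).hom_ext hH fun i => by simp
  · refine (hb.restrict sᶜ).hom_ext hH fun i => ?_
    have : i.1 ∉ s := i.2
    simp [this]
  · rintro ψ ⟨rfl, rfl⟩
    exact hb.hom_ext hH fun i => by simp

theorem isFreeFactor (hb : IsFreeBasis W b) (hinj : Function.Injective b) (s : Set ι) :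
    IsFreeFactor W (Subgroup.closure (b '' s)) := by
  have isFree_closure (t : Set ι) : IsFree W (Subgroup.closure (b '' t)) :=
    (hb.restrict t).isFree fun i j hij => Subtype.ext (hinj (congrArg Subtype.val hij))
  exact ⟨hb.isFree hinj, isFree_closure s, _, isFree_closure sᶜ, hb.isFreeProduct s⟩

theorem replace {B : Type u} [Group B] {ι' κ : Type*} {b : ι → B} {b' : ι' → B}
    (hb : IsFreeBasis W b) (hb' : IsFreeBasis W b') {β : B →* G} {y : κ → G}
    (h : IsFreeBasis W (Sum.elim (fun i => β (b i)) y)) :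
    IsFreeBasis W (Sum.elim (fun i => β (b' i)) y) := by
  refine ⟨h.1, fun H _ hH f => ?_⟩
  let ψ : B →* H := hb'.lift hH fun i => f (Sum.inl i)
  let φ : G →* H := h.lift hH (Sum.elim (fun i => ψ (b i)) fun k => f (Sum.inr k))
  have hφβ : φ.comp β = ψ := hb.hom_ext hH fun i => h.lift_apply hH _ (Sum.inl i)
  have hφb' (i) : φ (β (b' i)) = f (Sum.inl i) :=
    (DFunLike.congr_fun hφβ (b' i)).trans (hb'.lift_apply hH _ i)
  have hφy (k) : φ (y k) = f (Sum.inr k) := h.lift_apply hH _ (Sum.inr k)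
  refine ⟨φ, Sum.rec hφb' hφy, fun φ' hφ' => h.hom_ext hH ?_⟩
  have hφ'β : φ'.comp β = φ.comp β :=
    hb'.hom_ext hH fun i => (hφ' (Sum.inl i)).trans (hφb' i).symm
  rintro (i | k)
  · exact DFunLike.congr_fun hφ'β (b i)
  · exact (hφ' (Sum.inr k)).trans (hφy k).symm

end IsFreeBasis

theorem IsFreeProduct.isFreeBasis {B C D : Type u} [Group B] [Group C] [Group D] {β : B →* D}
    {γ : C →* D} (h : IsFreeProduct W β γ) {ι κ : Type*} {b : ι → B} {c : κ → C}
    (hb : IsFreeBasis W b) (hc : IsFreeBasis W c) :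
    IsFreeBasis W (Sum.elim (fun i => β (b i)) fun k => γ (c k)) := by
  refine ⟨h.1, fun H _ hH f => ?_⟩
  obtain ⟨φ, ⟨hφβ, hφγ⟩, -⟩ := h.2 H hH (hb.lift hH fun i => f (Sum.inl i))
    (hc.lift hH fun k => f (Sum.inr k))
  have hφb (i) : φ (β (b i)) = f (Sum.inl i) :=
    (DFunLike.congr_fun hφβ (b i)).trans (hb.lift_apply hH _ i)
  have hφc (k) : φ (γ (c k)) = f (Sum.inr k) :=
    (DFunLike.congr_fun hφγ (c k)).trans (hc.lift_apply hH _ k)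
  refine ⟨φ, Sum.rec hφb hφc, fun ψ hψ => ?_⟩
  refine (h.2 H hH (φ.comp β) (φ.comp γ)).unique ⟨?_, ?_⟩ ⟨rfl, rfl⟩
  · exact hb.hom_ext hH fun i => (hψ (Sum.inl i)).trans (hφb i).symm
  · exact hc.hom_ext hH fun k => (hψ (Sum.inr k)).trans (hφc k).symm

theorem IsFreeFactor.exists_basis {G : Type u} [Group G] {A : Subgroup G} (h : IsFreeFactor W A)
    {ι : Type*} {a : ι → A} (ha : IsFreeBasis W a) :
    ∃ (Z : Type u) (z : Z → G), IsFreeBasis W (Sum.elim (fun i => (a i : G)) z) := by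
  obtain ⟨-, -, C, ⟨X, hX⟩, hC⟩ := h
  exact ⟨X, fun x => (x : C), hC.isFreeBasis ha hX⟩

end Variety

/-- An injective homomorphism of groups, as an embedding of structures. -/
def homEmb {G : Type u} {H : Type w} [Group G] [Group H] (φ : G →* H)
    (hφ : Function.Injective φ) : G ↪[groupLang] H where
  toFun := φ
  inj' := hφ
  map_fun' := fun {_} f x => by
    match f, x with
    | GroupFunc.one, _ => exact φ.map_one
    | GroupFunc.inv, x => exact φ.map_inv (x 0)
    | GroupFunc.mul, x => exact φ.map_mul (x 0) (x 1)
  map_rel' := fun {_} r _ => nomatch r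

theorem range_homEmb {G : Type u} {H : Type w} [Group G] [Group H] (φ : G →* H)
    (hφ : Function.Injective φ) : (homEmb φ hφ).toHom.range = toSub φ.range := by
  ext x
  rw [FirstOrder.Language.Hom.mem_range]
  exact MonoidHom.mem_range.symm

/-- An isomorphism of groups, as an isomorphism of structures. -/
def mulEquivEquiv {G : Type u} {H : Type w} [Group G] [Group H] (e : G ≃* H) :
    G ≃[groupLang] H where
  toEquiv := e.toEquiv
  map_fun' := (homEmb e.toMonoidHom e.injective).map_fun'
  map_rel' := fun {_} r _ => nomatch r

section Definability

open FirstOrder.Language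

section Structure

variable {L : FirstOrder.Language.{0, 0}} {M : Type*} [L.Structure M]

theorem realize_congr_of_freeVar {α : Type*} [DecidableEq α] {φ : L.Formula α} {v v' : α → M}
    (h : ∀ a ∈ φ.freeVarFinset, v a = v' a) : φ.Realize v ↔ φ.Realize v' :=
  (BoundedFormula.realize_restrictFreeVar (φ := φ) (f := id) (v := fun a => v a) v
    fun _ => rfl).symm.trans (BoundedFormula.realize_restrictFreeVar v' fun a => h a a.2)

theorem IsQFDefinable.exists_finset_fixing {T : Set M} {z : M} (hz : IsQFDefinable L T z) :
    ∃ F : Finset M, (F : Set M) ⊆ T ∧ ∀ σ : M ≃[L] M, (∀ y ∈ F, σ y = y) → σ z = z := by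
  classical
  obtain ⟨φ, -, hφ⟩ := hz
  refine ⟨φ.freeVarFinset.toLeft.map (Function.Embedding.subtype _), by simp, fun σ hσ => ?_⟩
  rw [← hφ]
  have hz : φ.Realize (Sum.elim (fun t : T => (t : M)) fun _ => z) := (hφ z).2 rfl
  rw [← StrongHomClass.realize_formula σ] at hz
  refine (realize_congr_of_freeVar fun p hp => ?_).1 hz
  rcases p with t | _
  · exact hσ t (Finset.mem_map_of_mem _ (Finset.mem_toLeft.2 hp))
  · rfl

theorem dclQF_subset_of_automorphisms {S T : Set M} (hST : S ⊆ T)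
    (h : ∀ F : Finset M, (F : Set M) ⊆ T → ∀ x ∉ T,
      ∃ σ : M ≃[L] M, (∀ y ∈ F, σ y = y) ∧ σ x ≠ x) :
    dclQF L S ⊆ T := by
  refine Set.sInter_subset_of_mem ⟨hST, fun z hz => ?_⟩
  by_contra hzT
  obtain ⟨F, hFT, hF⟩ := hz.exists_finset_fixing
  obtain ⟨σ, hσF, hσz⟩ := h F hFT z hzT
  exact hσz (hF σ hσF)

end Structure

variable {α : Type*} {G : Type u} [Group G] {T : Set G}

/-- The product of two terms. -/
def mulTerm (s t : groupLang.Term α) : groupLang.Term α :=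
  Functions.apply₂ (L := groupLang) GroupFunc.mul s t

theorem realize_mulTerm (v : α → G) (s t : groupLang.Term α) :
    (mulTerm s t).realize v = s.realize v * t.realize v :=
  Term.realize_functions_apply₂ (L := groupLang) (f := GroupFunc.mul)

/-- The inverse of a term. -/
def invTerm (s : groupLang.Term α) : groupLang.Term α :=
  Functions.apply₁ (L := groupLang) GroupFunc.inv s

theorem realize_invTerm (v : α → G) (s : groupLang.Term α) :
    (invTerm s).realize v = (s.realize v)⁻¹ :=
  Term.realize_functions_apply₁ (L := groupLang) (f := GroupFunc.inv)

theorem isQFDefinable_of_equation {x : G} (s t : groupLang.Term (T ⊕ Unit))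
    (h : ∀ y, s.realize (Sum.elim (fun t : T => (t : G)) fun _ => y) =
      t.realize (Sum.elim (fun t : T => (t : G)) fun _ => y) ↔ y = x) :
    IsQFDefinable groupLang T x := by
  refine ⟨s.equal t, (BoundedFormula.IsAtomic.equal _ _).isQF, fun y => ?_⟩
  rw [Formula.realize_equal]
  exact h y

theorem isQFDefinable_mul {x y : G} (hx : x ∈ T) (hy : y ∈ T) :
    IsQFDefinable groupLang T (x * y) :=
  isQFDefinable_of_equation (Term.var (Sum.inr ()))
    (mulTerm (Term.var (Sum.inl ⟨x, hx⟩)) (Term.var (Sum.inl ⟨y, hy⟩))) fun z => by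
      rw [realize_mulTerm]
      exact Iff.rfl

theorem isQFDefinable_inv {x : G} (hx : x ∈ T) : IsQFDefinable groupLang T x⁻¹ :=
  isQFDefinable_of_equation (Term.var (Sum.inr ()))
    (invTerm (Term.var (Sum.inl ⟨x, hx⟩))) fun z => by
      rw [realize_invTerm]
      exact Iff.rfl

theorem isQFDefinable_of_sq {x : G} (hx : x * x ∈ T) (h : ∀ y, y * y = x * x → y = x) :
    IsQFDefinable groupLang T x :=
  isQFDefinable_of_equation
    (mulTerm (Term.var (Sum.inr ())) (Term.var (Sum.inr ())))
    (Term.var (Sum.inl ⟨x * x, hx⟩)) fun z => by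
      rw [realize_mulTerm]
      exact ⟨h z, fun hz => hz ▸ rfl⟩

end Definability

section TorsionFree

variable {W : Set (FreeGroup ℕ)}

/-- The homomorphism from the free abelian group on `ι`, encoded as `ι →₀ ℤ`, with prescribed
values on the basis. -/
noncomputable def freeAbelianLift {ι A : Type*} [CommGroup A] (v : ι → A) :
    Multiplicative (ι →₀ ℤ) →* A :=
  AddMonoidHom.toMultiplicativeLeft
    (Finsupp.liftAddHom fun i => zmultiplesHom (Additive A) (Additive.ofMul (v i)))

theorem freeAbelianLift_single {ι A : Type*} [CommGroup A] (v : ι → A) (i : ι) :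
    freeAbelianLift v (Multiplicative.ofAdd (Finsupp.single i 1)) = v i := by
  change Additive.toMul (Finsupp.liftAddHom _ (Finsupp.single i (1 : ℤ))) = v i
  rw [Finsupp.liftAddHom_apply_single]
  simp

theorem InVariety.of_comm (hℤ : InVariety W (Multiplicative ℤ)) (A : Type*) [CommGroup A] :
    InVariety W A := by
  intro r hr v
  let e (i : ℕ) : Multiplicative (ℕ →₀ ℤ) := Multiplicative.ofAdd (Finsupp.single i 1)
  have he : FreeGroup.lift e r = 1 := by
    apply Multiplicative.toAdd.injective
    ext i
    exact (map_freeGroup_lift (AddMonoidHom.toMultiplicative (Finsupp.applyAddHom i)) e r).trans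
      (hℤ r hr _)
  calc FreeGroup.lift v r = FreeGroup.lift (fun i => freeAbelianLift v (e i)) r := by
        simp only [e, freeAbelianLift_single]
    _ = 1 := by rw [← map_freeGroup_lift, he, map_one]

theorem InVariety.isNontrivialVariety (hℤ : InVariety W (Multiplicative ℤ)) :
    IsNontrivialVariety.{u} W :=
  ⟨Multiplicative (ULift.{u} ℤ), inferInstance, hℤ.of_comm _, inferInstance⟩

theorem IsTorsionFreeVariety.inVariety_int (hW : IsTorsionFreeVariety.{u} W) :
    InVariety W (Multiplicative ℤ) := by
  have hb := isFreeBasis_vfree_of (W := W) PUnit.{u + 1}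
  let x := VFree.of W PUnit.unit.{u + 1}
  have hx : x ≠ 1 := by
    intro hx
    have hmem : x ∉ Subgroup.closure (VFree.of W '' ∅) :=
      hb.notMem_closure_image hW.1 (Set.notMem_empty _)
    exact hmem (hx ▸ one_mem _)
  have hord : ¬ IsOfFinOrder x := by
    rw [isOfFinOrder_iff_pow_eq_one]
    rintro ⟨n, hn, hxn⟩
    exact hx (hW.2 _ (hb.isFree (hb.injective hW.1)) x n hn hxn)
  exact hb.1.of_injective (zpowersHom _ x) (injective_zpow_iff_not_isOfFinOrder.2 hord)

section SquareRoots

variable {C : Type*} [Group C] {c : ℕ → C}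

theorem eq_pow_two_pow_of_sqrt (hc : ∀ i, c i = c (i + 1) ^ 2) (i : ℕ) : c 0 = c i ^ 2 ^ i := by
  induction i with
  | zero => simp
  | succ i ih => rw [ih, hc i, ← pow_mul, pow_succ']

theorem map_int_eq_one_of_sqrt (hc : ∀ i, c i = c (i + 1) ^ 2) (χ : C →* Multiplicative ℤ) :
    χ (c 0) = 1 := by
  by_contra hne
  have hfin : FiniteMultiplicity (2 : ℤ) (Multiplicative.toAdd (χ (c 0))) :=
    Int.finiteMultiplicity_iff.2 ⟨by decide, hne⟩
  obtain ⟨n, hn⟩ := hfin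
  refine hn ⟨Multiplicative.toAdd (χ (c (n + 1))), ?_⟩
  rw [eq_pow_two_pow_of_sqrt hc (n + 1), map_pow, toAdd_pow, nsmul_eq_mul]
  push_cast
  rfl

end SquareRoots

theorem IsFree.map_eq_one_of_sqrt {C : Type u} [Group C] (hC : IsFree W C)
    (hℤ : InVariety W (Multiplicative ℤ)) {c : ℕ → C} (hc : ∀ i, c i = c (i + 1) ^ 2)
    {A : Type u} [CommGroup A] (ψ : C →* A) : ψ (c 0) = 1 := by
  obtain ⟨X, hX⟩ := hC
  let Φ : C →* Multiplicative (X →₀ ℤ) := hX.lift (hℤ.of_comm _)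
    fun x => Multiplicative.ofAdd (Finsupp.single x 1)
  have hψ : (freeAbelianLift fun x : X => ψ x).comp Φ = ψ :=
    hX.hom_ext (hℤ.of_comm _) fun x => by
      rw [MonoidHom.comp_apply, hX.lift_apply, freeAbelianLift_single]
  have hΦ : Φ (c 0) = 1 := by
    apply Multiplicative.toAdd.injective
    ext x
    exact map_int_eq_one_of_sqrt hc
      ((AddMonoidHom.toMultiplicative (Finsupp.applyAddHom x)).comp Φ)
  rw [← hψ, MonoidHom.comp_apply, hΦ, map_one]

end TorsionFree

section Witness

variable {W : Set (FreeGroup ℕ)} {B : Type u} [Group B]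

theorem IsFreeBasis.update_mul {ι : Type*} [DecidableEq ι] {b : ι → B} (hb : IsFreeBasis W b)
    (i : ι) {g : B} (hg : g ∈ Subgroup.closure (b '' {i}ᶜ)) :
    IsFreeBasis W (Function.update b i (b i * g)) := by
  refine of_closure hb.1 ?_ fun H _ hH f => ?_
  · let S := Subgroup.closure (Set.range (Function.update b i (b i * g)))
    have update_mem (j) : Function.update b i (b i * g) j ∈ S := Subgroup.subset_closure ⟨j, rfl⟩
    have mem_of_ne {j} (hj : j ≠ i) : b j ∈ S := by simpa [hj] using update_mem j
    have hgS : g ∈ S := by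
      refine (Subgroup.closure_le S).2 ?_ hg
      rintro _ ⟨j, hj, rfl⟩
      exact mem_of_ne hj
    rw [eq_top_iff, ← hb.closure_range, Subgroup.closure_le]
    rintro _ ⟨j, rfl⟩
    by_cases hj : j = i
    · subst hj
      exact (S.mul_mem_cancel_right hgS).1 (by simpa using update_mem j)
    · exact mem_of_ne hj
  · let φ₀ := hb.lift hH f
    let φ := hb.lift hH (Function.update f i (f i * (φ₀ g)⁻¹))
    have hφ {j} (hj : j ≠ i) : φ (b j) = f j := by simp [φ, hj]
    have hφg : φ g = φ₀ g := by
      refine MonoidHom.eqOn_closure (f := φ) (g := φ₀) ?_ hg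
      rintro _ ⟨j, hj, rfl⟩
      rw [hφ hj, hb.lift_apply]
    refine ⟨φ, fun j => ?_⟩
    by_cases hj : j = i
    · subst hj
      rw [Function.update_self, map_mul, hφg]
      simp [φ]
    · rw [Function.update_of_ne hj, hφ hj]

theorem isFreeBasis_closure_of_finset {ι : Type*} {a : ι → B} (hB : InVariety W B)
    (h : ∀ (s : Finset ι) (H : Type u) [Group H], InVariety W H → ∀ f : ι → H,
      ∃ φ : B →* H, ∀ i ∈ s, φ (a i) = f i) :
    IsFreeBasis W
      (fun i => (⟨a i, Subgroup.subset_closure ⟨i, rfl⟩⟩ : Subgroup.closure (Set.range a))) := by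
  let A := Subgroup.closure (Set.range a)
  let a' (i : ι) : A := ⟨a i, Subgroup.subset_closure ⟨i, rfl⟩⟩
  have hgen : Subgroup.closure (Set.range a') = ⊤ := closure_range_codRestrict a rfl _
  refine IsFreeBasis.of_closure (hB.subgroup A) hgen fun H _ hH f => ?_
  have hsurj : Function.Surjective (FreeGroup.lift a') := by
    rw [← MonoidHom.range_eq_top, FreeGroup.range_lift_eq_closure, hgen]
  have hker : (FreeGroup.lift a').ker ≤ (FreeGroup.lift f).ker := by
    intro r hr
    have hr_top : r ∈ Subgroup.closure (Set.range FreeGroup.of) := by simp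
    obtain ⟨s, hs⟩ := exists_finset_mem_closure hr_top
    obtain ⟨φ, hφ⟩ := h s H hH f
    have heq : Set.EqOn (FreeGroup.lift f) ((φ.comp A.subtype).comp (FreeGroup.lift a'))
        (FreeGroup.of '' s) := by
      rintro _ ⟨i, hi, rfl⟩
      simpa using (hφ i hi).symm
    rw [MonoidHom.mem_ker, MonoidHom.eqOn_closure heq hs, MonoidHom.comp_apply, hr, map_one]
  refine ⟨(FreeGroup.lift a').liftOfSurjective hsurj ⟨FreeGroup.lift f, hker⟩, fun i => ?_⟩
  simpa using MonoidHom.liftOfRightInverse_comp_apply (FreeGroup.lift a') _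
    (Function.rightInverse_surjInv hsurj) ⟨FreeGroup.lift f, hker⟩ (FreeGroup.of i)

/-- The family `b i * b (i + 1) ^ (-2)`: modulo its members, `b (i + 1)` is a square root
of `b i`. -/
def sqrtTwist {G : Type*} [Group G] (b : ℕ → G) (i : ℕ) : G :=
  b i * b (i + 1) ^ (-2 : ℤ)

theorem map_sqrtTwist {G H : Type*} [Group G] [Group H] (φ : G →* H) (b : ℕ → G) (i : ℕ) :
    φ (sqrtTwist b i) = sqrtTwist (φ ∘ b) i := by
  simp [sqrtTwist]

theorem sqrtTwist_eq_one_iff {G : Type*} [Group G] {b : ℕ → G} {i : ℕ} :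
    sqrtTwist b i = 1 ↔ b i = b (i + 1) ^ 2 := by
  rw [sqrtTwist, zpow_neg, mul_inv_eq_one, zpow_ofNat]

theorem IsFreeBasis.sqrtTwist_initial {b : ℕ → B} (hb : IsFreeBasis W b) (n : ℕ) :
    IsFreeBasis W (fun i => if i < n then sqrtTwist b i else b i) := by
  induction n with
  | zero => simpa using hb
  | succ n ih =>
    have hmem : b (n + 1) ∈
        Subgroup.closure ((fun i => if i < n then sqrtTwist b i else b i) '' {n}ᶜ) :=
      Subgroup.subset_closure ⟨n + 1, by simp, by simp⟩
    convert ih.update_mul n (zpow_mem hmem (-2)) using 2 with i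
    rcases lt_trichotomy i n with h | rfl | h
    · simp [h, h.ne, h.trans n.lt_succ_self]
    · simp [sqrtTwist]
    · simp [h.ne', h.not_gt, Nat.not_lt.2 (Nat.succ_le_of_lt h)]

theorem IsFreeFactor.exists_retraction {D : Type u} [Group D] {A : Subgroup D}
    (hA : IsFreeFactor W A) :
    ∃ (C : Subgroup D) (π : D →* C), IsFree W C ∧ A ≤ π.ker ∧
      ∀ (Q : Type u) [Group Q], InVariety W Q → ∀ ψ : D →* Q, A ≤ ψ.ker →
        (ψ.comp C.subtype).comp π = ψ := by
  obtain ⟨-, -, C, hC, hAC⟩ := hA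
  obtain ⟨π, ⟨hπA, hπC⟩, -⟩ := hAC.2 C (hAC.1.subgroup C) 1 (MonoidHom.id C)
  refine ⟨C, π, hC, fun x hx => ?_, fun Q _ hQ ψ hψ => ?_⟩
  · exact DFunLike.congr_fun hπA ⟨x, hx⟩
  · refine (hAC.2 Q hQ 1 (ψ.comp C.subtype)).unique ⟨?_, ?_⟩ ⟨?_, rfl⟩
    · rw [MonoidHom.comp_assoc, hπA, MonoidHom.comp_one]
    · rw [MonoidHom.comp_assoc, hπC, MonoidHom.comp_id]
    · exact MonoidHom.ext fun x => hψ x.2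

theorem IsFreeFactor.map_eq_one_of_sqrtTwist_mem (hℤ : InVariety W (Multiplicative ℤ))
    {D Q : Type u} [Group D] [CommGroup Q] {A : Subgroup D} (hA : IsFreeFactor W A) {d : ℕ → D}
    (hd : ∀ i, sqrtTwist d i ∈ A) {ψ : D →* Q} (hψ : A ≤ ψ.ker) : ψ (d 0) = 1 := by
  obtain ⟨C, π, hC, hπ, hfac⟩ := hA.exists_retraction
  have hsqrt (i) : π (d i) = π (d (i + 1)) ^ 2 :=
    sqrtTwist_eq_one_iff.1 ((map_sqrtTwist π d i).symm.trans (hπ (hd i)))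
  rw [← hfac Q (hℤ.of_comm Q) ψ hψ]
  exact hC.map_eq_one_of_sqrt hℤ hsqrt (ψ.comp C.subtype)

theorem exists_sqrtTwist_eq_one :
    ∃ (Q : Type u) (_ : CommGroup Q) (q : ℕ → Q), q 0 ≠ 1 ∧ ∀ i, sqrtTwist q i = 1 := by
  let q (i : ℕ) : Multiplicative (ULift.{u} ℚ) := Multiplicative.ofAdd (ULift.up (1 / 2 ^ i))
  refine ⟨_, inferInstance, q, fun h => ?_, fun i => sqrtTwist_eq_one_iff.2 ?_⟩
  · have h_zero : (1 / 2 ^ 0 : ℚ) = 0 := congrArg (fun x => (Multiplicative.toAdd x).down) h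
    norm_num at h_zero
  · apply Multiplicative.toAdd.injective
    apply ULift.down_injective
    change (1 / 2 ^ i : ℚ) = 2 • (1 / 2 ^ (i + 1) : ℚ)
    rw [pow_succ]
    simp

variable {b : ℕ → B}

theorem IsFreeBasis.not_isFreeFactor_sqrtTwist (hb : IsFreeBasis W b)
    (hℤ : InVariety W (Multiplicative ℤ)) {C D : Type u} [Group C] [Group D] {β : B →* D}
    {γ : C →* D} (hβγ : IsFreeProduct W β γ) :
    ¬ IsFreeFactor W ((Subgroup.closure (Set.range (sqrtTwist b))).map β) := by
  intro hA
  obtain ⟨Q, _, q, hq_zero, hq⟩ := exists_sqrtTwist_eq_one.{u}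
  have hQ : InVariety W Q := hℤ.of_comm Q
  obtain ⟨ψ, ⟨hψβ, -⟩, -⟩ := hβγ.2 Q hQ (hb.lift hQ q) 1
  have hψb : (ψ.comp β) ∘ b = q := funext fun i => by simp [hψβ]
  refine hq_zero (hψb ▸ hA.map_eq_one_of_sqrtTwist_mem hℤ (d := β ∘ b) (fun i => ?_) ?_)
  · rw [← map_sqrtTwist]
    exact Subgroup.mem_map_of_mem β (Subgroup.subset_closure ⟨i, rfl⟩)
  · rw [Subgroup.map_le_iff_le_comap, Subgroup.closure_le]
    rintro _ ⟨i, rfl⟩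
    exact (map_sqrtTwist (ψ.comp β) b i).trans (hψb ▸ hq i)

theorem closure_subset_dclQF {G : Type*} [Group G] {S X : Set G}
    (hS : S ⊆ dclQF groupLang X) (h1 : 1 ∈ X) :
    (Subgroup.closure S : Set G) ⊆ dclQF groupLang X := by
  rintro x hx T ⟨hXT, hT⟩
  let T' : Subgroup G :=
    { carrier := T
      mul_mem' := fun hx hy => hT _ (isQFDefinable_mul hx hy)
      one_mem' := hXT h1
      inv_mem' := fun hx => hT _ (isQFDefinable_inv hx) }
  exact (Subgroup.closure_le T').2 (fun y hy => hS hy T ⟨hXT, hT⟩) hx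

theorem IsFreeBasis.dclQF_sqrtTwist (hb : IsFreeBasis W b)
    (hroot : ∀ (i : ℕ) (y : B), y * y = b i * b i → y = b i) :
    dclQF groupLang ((Subgroup.closure (Set.range (sqrtTwist b)) : Set B) ∪ {b 0}) = Set.univ := by
  let A := Subgroup.closure (Set.range (sqrtTwist b))
  have hb_mem (i) : b i ∈ dclQF groupLang ((A : Set B) ∪ {b 0}) := by
    rintro T ⟨hAT, hT⟩
    induction i with
    | zero => exact hAT (Or.inr rfl)
    | succ i ih =>
      have ha : (sqrtTwist b i)⁻¹ ∈ T :=
        hAT (Or.inl (inv_mem (Subgroup.subset_closure ⟨i, rfl⟩)))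
      have hsq : (sqrtTwist b i)⁻¹ * b i = b (i + 1) * b (i + 1) := by
        simp [sqrtTwist, pow_two]
      exact hT _ (isQFDefinable_of_sq (hsq ▸ hT _ (isQFDefinable_mul ha ih)) (hroot (i + 1)))
  rw [Set.eq_univ_iff_forall]
  intro x
  refine closure_subset_dclQF (Set.range_subset_iff.2 hb_mem) (Or.inl (one_mem A)) ?_
  rw [hb.closure_range]
  exact Subgroup.mem_top x

theorem IsFreeBasis.isRCPWitness_sqrtTwist (hb : IsFreeBasis W b)
    (hℤ : InVariety W (Multiplicative ℤ))
    (hroot : ∀ (i : ℕ) (y : B), y * y = b i * b i → y = b i) :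
    IsRCPWitness W B (sqrtTwist b) b where
  free_b := hb
  free_a := isFreeBasis_closure_of_finset hb.1 fun s H _ hH f => by
    obtain ⟨n, hn⟩ := s.exists_nat_subset_range
    refine ⟨(hb.sqrtTwist_initial n).lift hH f, fun i hi => ?_⟩
    simpa [Finset.mem_range.1 (hn hi)] using (hb.sqrtTwist_initial n).lift_apply hH f i
  initial_factor i := by
    have hbasis := hb.sqrtTwist_initial (i + 1)
    convert hbasis.isFreeFactor (hbasis.injective hℤ.isNontrivialVariety) {j | j ≤ i} using 2
    refine Set.image_congr fun j hj => ?_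
    rw [if_pos (Nat.lt_succ_of_le hj)]
  not_factor _ _ _ _ _ _ _ h := hb.not_isFreeFactor_sqrtTwist hℤ h
  dcl_eq := hb.dclQF_sqrtTwist hroot

end Witness

section Automorphisms

variable {W : Set (FreeGroup ℕ)} {B : Type u} [Group B]

namespace IsFreeBasis

variable {ι : Type w} {c : ι → B}

theorem closure_image_inf_closure_image (hc : IsFreeBasis W c) (s t : Set ι) :
    Subgroup.closure (c '' s) ⊓ Subgroup.closure (c '' t) = Subgroup.closure (c '' (s ∩ t)) := by
  classical
  refine le_antisymm (fun x ⟨hxs, hxt⟩ => ?_) (le_inf (Subgroup.closure_mono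
    (Set.image_mono Set.inter_subset_left)) (Subgroup.closure_mono
    (Set.image_mono Set.inter_subset_right)))
  let r : B →* B := hc.lift hc.1 fun i => if i ∈ s then c i else 1
  have hrx : r x = x := by
    refine MonoidHom.eqOn_closure (f := r) (g := MonoidHom.id B) ?_ hxs
    rintro _ ⟨i, hi, rfl⟩
    simp [r, hi]
  have hr : Subgroup.closure (c '' t) ≤ (Subgroup.closure (c '' (s ∩ t))).comap r := by
    rw [Subgroup.closure_le]
    rintro _ ⟨i, hi, rfl⟩
    by_cases his : i ∈ s
    · have hmem : c i ∈ Subgroup.closure (c '' (s ∩ t)) :=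
        Subgroup.subset_closure ⟨i, ⟨his, hi⟩, rfl⟩
      simpa [r, his] using hmem
    · simp [r, his]
  exact hrx ▸ hr hxt

theorem exists_mulEquiv (hc : IsFreeBasis W c) (τ : Equiv.Perm ι) :
    ∃ σ : B ≃* B, ∀ i, σ (c i) = c (τ i) := by
  refine ⟨MonoidHom.toMulEquiv (hc.lift hc.1 fun i => c (τ i))
    (hc.lift hc.1 fun i => c (τ.symm i)) (hc.hom_ext hc.1 fun i => by simp)
    (hc.hom_ext hc.1 fun i => by simp), fun i => ?_⟩
  exact hc.lift_apply hc.1 _ i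

theorem mem_closure_image_swap_of_fixed [DecidableEq ι] (hc : IsFreeBasis W c) {s t : Set ι}
    {k k' : ι} (hk : k ∉ s) (hk' : k' ∉ s) {x : B}
    (hx : ∀ σ : B ≃* B, (∀ i ∈ s, σ (c i) = c i) → σ x = x)
    (hxt : x ∈ Subgroup.closure (c '' t)) :
    x ∈ Subgroup.closure (c '' (Equiv.swap k k' '' t)) := by
  obtain ⟨σ, hσ⟩ := hc.exists_mulEquiv (Equiv.swap k k')
  have hσs (i) (hi : i ∈ s) : σ (c i) = c i := by
    rw [hσ, Equiv.swap_apply_of_ne_of_ne (ne_of_mem_of_not_mem hi hk) (ne_of_mem_of_not_mem hi hk')]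
  have himage : c '' (Equiv.swap k k' '' t) = σ.toMonoidHom '' (c '' t) := by
    simp only [Set.image_image, MulEquiv.coe_toMonoidHom, hσ]
  rw [himage, ← MonoidHom.map_closure]
  exact ⟨x, hxt, hx σ hσs⟩

theorem mem_closure_image_of_fixed (hc : IsFreeBasis W c) {s : Set ι} (hs : sᶜ.Infinite) {x : B}
    (hx : ∀ σ : B ≃* B, (∀ i ∈ s, σ (c i) = c i) → σ x = x) :
    x ∈ Subgroup.closure (c '' s) := by
  classical
  have remove (F : Finset ι) (hF : x ∈ Subgroup.closure (c '' (s ∪ F))) :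
      x ∈ Subgroup.closure (c '' s) := by
    induction F using Finset.induction_on with
    | empty => simpa using hF
    | insert k F _ ih =>
      by_cases hk : k ∈ s
      · exact ih (by simpa [Set.insert_eq_of_mem (Set.mem_union_left _ hk)] using hF)
      obtain ⟨k', hk', hk'F⟩ := hs.exists_notMem_finset (insert k F)
      -- Swapping `k` with a fresh `k'` removes `k` from the basis elements needed for `x`.
      have hinter := (hc.closure_image_inf_closure_image _ _).le
        ⟨hF, hc.mem_closure_image_swap_of_fixed hk hk' hx hF⟩
      refine ih (Subgroup.closure_mono (Set.image_mono ?_) hinter)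
      rintro i ⟨hi, j, hj, rfl⟩
      have hjk' : j ≠ k' := by
        rintro rfl
        exact hj.elim hk' hk'F
      have hjk : Equiv.swap k k' j ≠ k := by
        rwa [Ne, Equiv.swap_apply_eq_iff, Equiv.swap_apply_left]
      simpa [hjk] using hi
  obtain ⟨F, hF⟩ := exists_finset_mem_closure (hc.closure_range ▸ Subgroup.mem_top x)
  exact remove F (Subgroup.closure_mono (Set.image_mono Set.subset_union_right) hF)

theorem infinite_of_infinite (hW : IsNontrivialVariety.{u} W)
    {κ : Type*} [Infinite ι] {b : κ → B} (hc : IsFreeBasis W c) (hb : IsFreeBasis W b) :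
    Infinite κ := by
  classical
  by_contra hfin
  rw [not_infinite_iff_finite] at hfin
  have := Fintype.ofFinite κ
  choose F hF using fun k => exists_finset_mem_closure (hc.closure_range ▸ Subgroup.mem_top (b k))
  let U : Finset ι := Finset.univ.biUnion F
  have htop : Subgroup.closure (c '' (U : Set ι)) = ⊤ := by
    rw [eq_top_iff, ← hb.closure_range, Subgroup.closure_le]
    rintro _ ⟨k, rfl⟩
    refine Subgroup.closure_mono (Set.image_mono ?_) (hF k)
    exact Finset.coe_subset.2 (Finset.subset_biUnion_of_mem F (Finset.mem_univ k))
  obtain ⟨i, hi⟩ := Infinite.exists_notMem_finset U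
  exact hc.notMem_closure_image hW (s := U) hi (htop ▸ Subgroup.mem_top _)

end IsFreeBasis

theorem isFree_of_subsingleton (W : Set (FreeGroup ℕ)) (C : Type u) [Group C] [Subsingleton C] :
    IsFree W C :=
  ⟨∅, fun _ _ _ => Subsingleton.elim _ _, fun _ _ _ _ =>
    ⟨1, fun i => i.2.elim, fun _ _ => MonoidHom.ext fun x => by
      rw [Subsingleton.elim x 1, map_one, map_one]⟩⟩

theorem isFreeProduct_id (hB : InVariety W B) {C : Type u} [Group C] [Subsingleton C]
    (γ : C →* B) : IsFreeProduct W (MonoidHom.id B) γ := by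
  refine ⟨hB, fun H _ _ f g => ⟨f, ⟨rfl, MonoidHom.ext fun x => ?_⟩, fun φ hφ => hφ.1⟩⟩
  rw [Subsingleton.elim x 1, map_one, map_one]

theorem exists_nat_mem_closure {ι : Type*} {c : ι → B} (ℓ : ι → ℕ) {x : B}
    (hx : x ∈ Subgroup.closure (Set.range c)) :
    ∃ n, ∀ m ≥ n, x ∈ Subgroup.closure (c '' {i | ℓ i ≤ m}) := by
  obtain ⟨F, hF⟩ := exists_finset_mem_closure hx
  refine ⟨F.sup ℓ, fun m hm => Subgroup.closure_mono (Set.image_mono fun i hi => ?_) hF⟩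
  exact (Finset.le_sup hi).trans hm

namespace IsRCPWitness

variable {a b : ℕ → B}

theorem exists_basis (h : IsRCPWitness W B a b) (i : ℕ) :
    ∃ (Z : Type u) (z : Z → B), IsFreeBasis W (Sum.elim (fun j : {j | j ≤ i} => a j) z) := by
  classical
  let s := {j | j ≤ i}
  refine (h.initial_factor i).exists_basis (a := fun j : s => ⟨a j, Subgroup.subset_closure
    ⟨j, j.2, rfl⟩⟩) (.of_closure (h.free_b.1.subgroup _) ?_ fun H _ hH f => ?_)
  · exact closure_range_codRestrict (fun j : s => a j) (by rw [Set.image_eq_range]) _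
  · refine ⟨(h.free_a.lift hH fun j => if hj : j ∈ s then f ⟨j, hj⟩ else 1).comp
      (Subgroup.inclusion (Subgroup.closure_mono (Set.image_subset_range a s))), fun j => ?_⟩
    exact (h.free_a.lift_apply hH _ j).trans (dif_pos j.2)

theorem closure_ne_top (h : IsRCPWitness W B a b)
    (hW : IsNontrivialVariety.{u} W) :
    Subgroup.closure (Set.range a) ≠ ⊤ := by
  intro htop
  refine h.not_factor PUnit.{u + 1} B (MonoidHom.id B) 1 (isFree_of_subsingleton W _)
    (isFreeProduct_id h.free_b.1 1) ?_
  rw [Subgroup.map_id, htop, ← h.free_b.closure_range, ← Set.image_univ]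
  exact h.free_b.isFreeFactor (h.free_b.injective hW) Set.univ

theorem dclQF_subset (h : IsRCPWitness W B a b)
    (hW : IsNontrivialVariety.{u} W) {S : Set B}
    (hS : S ⊆ Subgroup.closure (Set.range a)) :
    dclQF groupLang S ⊆ (Subgroup.closure (Set.range a) : Set B) := by
  refine dclQF_subset_of_automorphisms hS fun F hF x hx => ?_
  choose! n hn using fun y (hy : y ∈ F) => exists_nat_mem_closure id (hF hy)
  obtain ⟨Z, z, hz⟩ := h.exists_basis (F.sup n)
  have hinf : (Set.range (Sum.inl : {j | j ≤ F.sup n} → _ ⊕ Z))ᶜ.Infinite := by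
    have := h.free_b.infinite_of_infinite hW hz
    exact (Set.finite_range _).infinite_compl
  by_contra! hσ
  refine hx (Subgroup.closure_mono ?_ (hz.mem_closure_image_of_fixed hinf (x := x) fun σ hσa =>
    hσ (mulEquivEquiv σ) fun y hy => ?_))
  · rintro _ ⟨_, ⟨j, rfl⟩, rfl⟩
    exact ⟨j, rfl⟩
  · refine MonoidHom.eqOn_closure (f := σ.toMonoidHom) (g := MonoidHom.id B) ?_
      (hn y hy _ (Finset.le_sup hy))
    rintro _ ⟨j, hj, rfl⟩
    exact hσa (Sum.inl ⟨j, hj⟩) ⟨_, rfl⟩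

theorem b_zero_notMem (h : IsRCPWitness W B a b)
    (hW : IsNontrivialVariety.{u} W) :
    b 0 ∉ Subgroup.closure (Set.range a) := by
  intro hmem
  have hdcl := h.dclQF_subset hW (Set.union_subset subset_rfl (Set.singleton_subset_iff.2 hmem))
  rw [h.dcl_eq, Set.univ_subset_iff] at hdcl
  exact h.closure_ne_top hW (SetLike.coe_injective hdcl)

end IsRCPWitness

end Automorphisms

section Covering

variable {W : Set (FreeGroup ℕ)} {K : AbstractClass.{u} groupLang} {G H : Type u} [Group G]
  [Group H] {ι κ : Type*} {c : ι → G} {θ : G →* H}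

theorem IsFreeBasis.injOn_closure {e : ι → H} {d : κ → H} (hd : IsFreeBasis W (Sum.elim e d))
    (hG : InVariety W G) (hθ : ∀ i, θ (c i) = e i) :
    Set.InjOn θ (Subgroup.closure (Set.range c)) := by
  let ρ : H →* G := hd.lift hG (Sum.elim c 1)
  have hρ : Set.EqOn (ρ.comp θ) (MonoidHom.id G) (Set.range c) := by
    rintro _ ⟨i, rfl⟩
    exact (congrArg ρ (hθ i)).trans (hd.lift_apply hG _ (Sum.inl i))
  exact Set.LeftInvOn.injOn (f₁' := ρ) (MonoidHom.eqOn_closure hρ)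

namespace IsAECCovering

open AbstractClass

variable (hcov : IsAECCovering W K) (hW : IsNontrivialVariety.{u} W)
include hcov hW

theorem mem_of_basis [Infinite ι] (hc : IsFreeBasis W c) : K.Mem G :=
  hcov.free_mem G (hc.isFreeInf (hc.injective hW))

theorem closure_range_mem_strong [Infinite ι] {e : ι → H} {d : κ → H}
    (hd : IsFreeBasis W (Sum.elim e d)) :
    toSub (Subgroup.closure (Set.range e)) ∈ K.strong (asStr groupLang H) := by
  have hrange : Sum.elim e d '' Set.range Sum.inl = Set.range e := by
    rw [← Set.range_comp, Sum.elim_comp_inl]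
  have : Infinite (Set.range (Sum.inl : ι → ι ⊕ κ)) :=
    (Set.infinite_range_of_injective Sum.inl_injective).to_subtype
  rw [← hrange]
  exact hcov.strong_of_factor H _ (hcov.mem_of_basis hW hd)
    (hcov.mem_of_basis hW (hd.restrict _)) (hd.isFreeFactor (hd.injective hW) _)

theorem strong_of_basis [Infinite ι] {d : κ → H} (hc : IsFreeBasis W c)
    (hd : IsFreeBasis W (Sum.elim (fun i => θ (c i)) d)) :
    ∃ hinj : Function.Injective θ, K.Strong (homEmb θ hinj) := by
  have hinj : Function.Injective θ := by
    have hinjOn := hd.injOn_closure hc.1 fun _ => rfl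
    rwa [hc.closure_range, Subgroup.coe_top, Set.injOn_univ] at hinjOn
  have hrange : Subgroup.closure (Set.range fun i => θ (c i)) = θ.range := by
    rw [MonoidHom.range_eq_map, ← hc.closure_range, MonoidHom.map_closure, ← Set.range_comp]
    rfl
  refine ⟨hinj, ?_⟩
  rw [Strong, range_homEmb, ← hrange]
  exact hcov.closure_range_mem_strong hW hd

theorem strong_of_filtration (hc : IsFreeBasis W c) (ℓ : ι → ℕ)
    (hinf : ∀ n, {i | ℓ i ≤ n}.Infinite)
    (hext : ∀ n, ∃ (Z : Type u) (z : Z → H),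
      IsFreeBasis W (Sum.elim (fun i : {i | ℓ i ≤ n} => θ (c i)) z)) :
    ∃ hinj : Function.Injective θ, K.Strong (homEmb θ hinj) := by
  choose Z z hz using hext
  let A (n : ℕ) : Subgroup G := Subgroup.closure (c '' {i | ℓ i ≤ n})
  have hA_mono : Monotone A := fun m n hmn =>
    Subgroup.closure_mono (Set.image_mono fun i hi => le_trans hi hmn)
  have hA_mem (g : G) : ∃ n, ∀ m ≥ n, g ∈ A m :=
    exists_nat_mem_closure ℓ (hc.closure_range ▸ Subgroup.mem_top g)
  have hinj : Function.Injective θ := by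
    intro g h hgh
    obtain ⟨m, hm⟩ := hA_mem g
    obtain ⟨n, hn⟩ := hA_mem h
    refine (hz (max m n)).injOn_closure hc.1 (fun _ => rfl) ?_ ?_ hgh <;> rw [← Set.image_eq_range]
    · exact hm _ (le_max_left m n)
    · exact hn _ (le_max_right m n)
  have hstrong (n : ℕ) : toSub ((A n).map θ) ∈ K.strong (asStr groupLang H) := by
    have := (hinf n).to_subtype
    rw [MonoidHom.map_closure, Set.image_image, Set.image_eq_range]
    exact hcov.closure_range_mem_strong hW (hz n)
  have hrange : (homEmb θ hinj).toHom.range = ⨆ n : ULift.{u} ℕ, toSub ((A n.down).map θ) := by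
    rw [range_homEmb]
    apply le_antisymm
    · rintro _ ⟨g, rfl⟩
      obtain ⟨n, hn⟩ := hA_mem g
      exact le_iSup (fun n : ULift.{u} ℕ => toSub ((A n.down).map θ)) ⟨n⟩ ⟨g, hn n le_rfl, rfl⟩
    · refine iSup_le fun n => ?_
      rintro _ ⟨g, -, rfl⟩
      exact ⟨g, rfl⟩
  refine ⟨hinj, ?_⟩
  rw [Strong, hrange]
  refine hcov.isAEC.iSup_mem_strong (fun m n hmn x hx => ?_) fun n => hstrong n.down
  exact Subgroup.map_mono (f := θ) (hA_mono hmn) hx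

/-- Smoothness is what makes `A * Y ≼ B * Y`, although `A` is not a free factor: `A * Y` is the
union of the free factors generated by `Y` and initial segments of `a`. -/
theorem strong_of_witness {B : Type u} [Group B] {a b : ℕ → B} (hB : IsRCPWitness W B a b)
    {Y : Type*} [Infinite Y] {α : ℕ → G} {y' : Y → G} {y : Y → H} {β : B →* H}
    (hG : IsFreeBasis W (Sum.elim α y')) (hH : IsFreeBasis W (Sum.elim (fun i => β (b i)) y))
    (hα : ∀ i, θ (α i) = β (a i)) (hy : ∀ k, θ (y' k) = y k) :
    ∃ hinj : Function.Injective θ, K.Strong (homEmb θ hinj) := by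
  let ℓ : ℕ ⊕ Y → ℕ := Sum.elim id 0
  refine hcov.strong_of_filtration hW hG ℓ (fun n => ?_) fun n => ?_
  · refine (Set.infinite_range_of_injective Sum.inr_injective).mono ?_
    rintro _ ⟨k, rfl⟩
    exact Nat.zero_le n
  · obtain ⟨Z, z, hz⟩ := hB.exists_basis n
    let e : {i | ℓ i ≤ n} ⊕ Z ≃ ({j | j ≤ n} ⊕ Z) ⊕ Y :=
      { toFun := Sum.elim
          (fun | ⟨.inl j, hj⟩ => .inl (.inl ⟨j, hj⟩) | ⟨.inr k, _⟩ => .inr k)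
          fun t => .inl (.inr t)
        invFun := Sum.elim
          (Sum.elim (fun j => .inl ⟨.inl j, j.2⟩) .inr) fun k => .inl ⟨.inr k, Nat.zero_le n⟩
        left_inv := by rintro (⟨j | k, _⟩ | t) <;> rfl
        right_inv := by rintro ((j | t) | k) <;> rfl }
    refine ⟨Z, fun t => β (z t), (hB.free_b.replace hz hH).reindex_bijective e e.bijective ?_⟩
    rintro (⟨j | k, _⟩ | t)
    · exact (hα j).symm
    · exact (hy k).symm
    · rfl

end IsAECCovering

end Covering

section Branches

variable {W : Set (FreeGroup ℕ)} {B Q : Type u} [Group B] [Group Q] {a b : ℕ → B}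

section Double

variable {ι : Type} {Z R : Type u} {c : ι → B} {z : Z → B} {r : R → Q} {γ γ' : B →* Q}

variable (W c z r γ γ') in
/-- `Q` is the free product of the free group on `r` and of two copies of `B`, embedded by `γ` and
`γ'`, amalgamated over the free factor generated by `c`, with complementary basis `z`. -/
structure IsDouble : Prop where
  basis : IsFreeBasis W
    (Sum.elim (fun i => γ (Sum.elim c z i)) (Sum.elim r fun t => γ' (z t)))
  agree : ∀ i, γ (c i) = γ' (c i)

theorem IsDouble.symm (h : IsDouble W c z r γ γ') : IsDouble W c z r γ' γ := by
  refine ⟨h.basis.reindex_bijective (Sum.elim (Sum.elim (.inl ∘ .inl) (.inr ∘ .inr))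
    (Sum.elim (.inr ∘ .inl) (.inl ∘ .inr))) (Function.Involutive.bijective ?_) ?_,
    fun i => (h.agree i).symm⟩ <;> rintro ((i | t) | (x | t))
  case refine_2.inl.inl => exact h.agree i
  all_goals rfl

theorem IsFreeBasis.exists_isDouble (hz : IsFreeBasis W (Sum.elim c z)) (R : Type u) :
    ∃ (Q : Type u) (_ : Group Q) (r : R → Q) (γ γ' : B →* Q), IsDouble W c z r γ γ' := by
  let T := (ULift.{u} ι ⊕ Z) ⊕ (R ⊕ Z)
  let γ : B →* VFree W T := hz.lift (inVariety_vfree T) fun i =>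
    VFree.of W (.inl (Sum.map ULift.up id i))
  let γ' : B →* VFree W T := hz.lift (inVariety_vfree T)
    (Sum.elim (fun i => VFree.of W (.inl (.inl ⟨i⟩))) fun t => VFree.of W (.inr (.inr t)))
  have hγ (i) : γ (Sum.elim c z i) = VFree.of W (.inl (Sum.map ULift.up id i)) :=
    hz.lift_apply _ _ i
  have hγ'c (i) : γ' (c i) = VFree.of W (.inl (.inl ⟨i⟩)) := hz.lift_apply _ _ (.inl i)
  have hγ'z (t) : γ' (z t) = VFree.of W (.inr (.inr t)) := hz.lift_apply _ _ (.inr t)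
  refine ⟨VFree W T, inferInstance, fun x => VFree.of W (.inr (.inl x)), γ, γ',
    (isFreeBasis_vfree_of T).reindex_bijective (Sum.map (Sum.map ULift.up id) id) ?_ ?_,
    fun i => (hγ (.inl i)).trans (hγ'c i).symm⟩
  · exact (Equiv.ulift.symm.bijective.sumMap Function.bijective_id).sumMap Function.bijective_id
  · rintro (i | x | t)
    · exact (hγ i).symm
    · rfl
    · exact (hγ'z t).symm

theorem IsDouble.mem_closure_of_apply_eq (h : IsDouble W c z r γ γ')
    (hz : IsFreeBasis W (Sum.elim c z)) {x y : B} (hxy : γ x = γ' y) :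
    x ∈ Subgroup.closure (Set.range c) := by
  let ρ : Q →* B := h.basis.lift hz.1 (Sum.elim (Sum.elim c z) 1)
  have hργ : ρ.comp γ = MonoidHom.id B :=
    hz.hom_ext hz.1 fun i => h.basis.lift_apply hz.1 _ (.inl i)
  have hργ' : (Subgroup.closure (Set.range c)).comap (ρ.comp γ') = ⊤ := by
    rw [eq_top_iff, ← hz.closure_range, Subgroup.closure_le]
    rintro _ ⟨i | t, rfl⟩
    · have hc : ρ (γ' (c i)) = c i := h.agree i ▸ DFunLike.congr_fun hργ (c i)
      change ρ (γ' (c i)) ∈ Subgroup.closure (Set.range c)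
      rw [hc]
      exact Subgroup.subset_closure ⟨i, rfl⟩
    · have ht : ρ (γ' (z t)) = 1 := h.basis.lift_apply hz.1 _ (.inr (.inr t))
      change ρ (γ' (z t)) ∈ Subgroup.closure (Set.range c)
      rw [ht]
      exact one_mem _
  have hx : ρ (γ' y) = x := hxy ▸ DFunLike.congr_fun hργ x
  have hy : y ∈ (Subgroup.closure (Set.range c)).comap (ρ.comp γ') := hργ' ▸ Subgroup.mem_top y
  exact hx ▸ hy

end Double

variable {M P : Type u} [Group M] [Group P] {X : Type*} {c : X → M} {p q : ℕ → X} {m : M →* P}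
  {β : B →* P}

variable (W a b c p m β) in
/-- For `M` free on `c`, the group `P` is the pushout of `M` and `B` along the identification of
`c (p i)` with `a i`; the branch is the extension `m : M → P`. -/
structure IsBranch : Prop where
  basis : IsFreeBasis W
    (Sum.elim (fun i => β (b i)) fun x : ((Set.range p)ᶜ : Set X) => m (c x))
  map_branch : ∀ i, m (c (p i)) = β (a i)

theorem IsFreeBasis.exists_isBranch {X : Type u} {c : X → M} {p : ℕ → X} (hc : IsFreeBasis W c)
    (hb : IsFreeBasis W b) (hp : Function.Injective p) :
    ∃ (P : Type u) (_ : Group P) (m : M →* P) (β : B →* P), IsBranch W a b c p m β := by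
  let T := ULift.{u} ℕ ⊕ ((Set.range p)ᶜ : Set X)
  have hv : InVariety W (VFree W T) := inVariety_vfree T
  let β : B →* VFree W T := hb.lift hv fun i => VFree.of W (.inl ⟨i⟩)
  let m : M →* VFree W T := hc.lift hv (Function.extend p (fun i => β (a i))
    (Function.extend Subtype.val (fun x => VFree.of W (.inr x)) 1))
  refine ⟨VFree W T, inferInstance, m, β, (isFreeBasis_vfree_of T).reindex_bijective
    (Sum.map ULift.up id) (Equiv.ulift.symm.bijective.sumMap Function.bijective_id) ?_,
    fun i => ?_⟩
  · rintro (i | x)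
    · exact (hb.lift_apply hv (fun i => VFree.of W (.inl ⟨i⟩ : T)) i).symm
    · have hx : ¬∃ i, p i = x.1 := x.2
      change _ = m (c x)
      rw [hc.lift_apply hv, Function.extend_apply' _ _ _ hx, Subtype.val_injective.extend_apply]
      rfl
  · rw [hc.lift_apply hv, hp.extend_apply]

theorem IsBranch.exists_lift (h : IsBranch W a b c p m β) (hb : IsFreeBasis W b)
    (hQ : InVariety W Q) (γ : B →* Q) (f : X → Q) (hf : ∀ i, f (p i) = γ (a i)) :
    ∃ i : P →* Q, i.comp β = γ ∧ ∀ x, i (m (c x)) = f x := by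
  let i : P →* Q := h.basis.lift hQ (Sum.elim (fun j => γ (b j)) fun x => f x)
  have hi : i.comp β = γ := hb.hom_ext hQ fun j => h.basis.lift_apply hQ _ (.inl j)
  refine ⟨i, hi, fun x => ?_⟩
  by_cases hx : x ∈ Set.range p
  · obtain ⟨j, rfl⟩ := hx
    rw [h.map_branch, hf]
    exact DFunLike.congr_fun hi (a j)
  · exact h.basis.lift_apply hQ _ (.inr ⟨x, hx⟩)

section SplitsAt

variable (p q) in
/-- The sequences `p` and `q` agree up to `k`, and have no values in common after that. -/
structure SplitsAt (k : ℕ) : Prop where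
  eq_of_le : ∀ j ≤ k, p j = q j
  eq_and_le : ∀ i j, p i = q j → i = j ∧ i ≤ k

variable {k : ℕ}

theorem SplitsAt.symm (h : SplitsAt p q k) : SplitsAt q p k where
  eq_of_le j hj := (h.eq_of_le j hj).symm
  eq_and_le i j hij := by
    obtain ⟨rfl, hj⟩ := h.eq_and_le j i hij.symm
    exact ⟨rfl, hj⟩

theorem SplitsAt.image_eq_range_inter_range (h : SplitsAt p q k) :
    p '' {j | j ≤ k} = Set.range p ∩ Set.range q := by
  ext x
  constructor
  · rintro ⟨j, hj, rfl⟩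
    exact ⟨⟨j, rfl⟩, j, (h.eq_of_le j hj).symm⟩
  · rintro ⟨⟨i, rfl⟩, j, hij⟩
    exact ⟨i, (h.eq_and_le i j hij.symm).2, rfl⟩

theorem SplitsAt.exists_equiv (h : SplitsAt p q k) (hp : Function.Injective p)
    (hq : Function.Injective q) :
    ∃ e : ℕ ⊕ ((Set.range p ∪ Set.range q)ᶜ : Set X) ≃ {j | j ≤ k} ⊕ ((Set.range p)ᶜ : Set X),
      ∀ x, Sum.elim (fun j : {j | j ≤ k} => p j) Subtype.val (e x) =
        Sum.elim q Subtype.val x := by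
  have hφ : Function.Injective (Sum.elim (fun j : {j | j ≤ k} => p j)
      (Subtype.val : ((Set.range p)ᶜ : Set X) → X)) :=
    (hp.comp Subtype.val_injective).sumElim Subtype.val_injective fun j x hx => x.2 ⟨j, hx⟩
  have hψ : Function.Injective (Sum.elim q
      (Subtype.val : ((Set.range p ∪ Set.range q)ᶜ : Set X) → X)) :=
    hq.sumElim Subtype.val_injective fun j x hx => x.2 (.inr ⟨j, hx⟩)
  have hrange : Set.range (Sum.elim q (Subtype.val : ((Set.range p ∪ Set.range q)ᶜ : Set X) → X)) =
      Set.range (Sum.elim (fun j : {j | j ≤ k} => p j)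
        (Subtype.val : ((Set.range p)ᶜ : Set X) → X)) := by
    rw [Set.Sum.elim_range, Set.Sum.elim_range, ← Set.image_eq_range, Subtype.range_coe,
      Subtype.range_coe, h.image_eq_range_inter_range]
    ext x
    simp only [Set.mem_union, Set.mem_inter_iff, Set.mem_compl_iff]
    tauto
  exact ⟨(Equiv.ofInjective _ hψ).trans ((Equiv.setCongr hrange).trans
    (Equiv.ofInjective _ hφ).symm), fun x => Equiv.apply_ofInjective_symm hφ _⟩

theorem IsBranch.isFreeBasis_of_splitsAt (h : IsBranch W a b c p m β) (hb : IsFreeBasis W b)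
    (hpq : SplitsAt p q k) (hp : Function.Injective p) (hq : Function.Injective q)
    {Z : Type*} {z : Z → B} (hz : IsFreeBasis W (Sum.elim (fun j : {j | j ≤ k} => a j) z)) :
    IsFreeBasis W (Sum.elim (fun j => m (c (q j)))
      (Sum.elim (fun x : ((Set.range p ∪ Set.range q)ᶜ : Set X) => m (c x))
        fun t => β (z t))) := by
  obtain ⟨e, he⟩ := hpq.exists_equiv hp hq
  have hbasis : IsFreeBasis W (Sum.elim (fun x => m (c (Sum.elim (fun j : {j | j ≤ k} => p j)
      (Subtype.val : ((Set.range p)ᶜ : Set X) → X) x))) fun t => β (z t)) := by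
    refine (hb.replace hz h.basis).reindex_bijective _ ((Equiv.sumAssoc _ _ _).trans
      (((Equiv.refl _).sumCongr (Equiv.sumComm _ _)).trans
        (Equiv.sumAssoc _ _ _).symm)).bijective ?_
    rintro ((j | x) | t)
    · exact (h.map_branch j).symm
    · rfl
    · rfl
  refine hbasis.reindex_bijective _ ((Equiv.sumAssoc _ _ _).symm.trans
    (e.sumCongr (Equiv.refl Z))).bijective ?_
  rintro (j | x | t)
  · exact congrArg (fun x => m (c x)) (he (.inl j))
  · exact congrArg (fun x => m (c x)) (he (.inr x))
  · rfl

end SplitsAt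

theorem exists_extend_two {Y : Type*} [Nonempty Y] {g h : ℕ → Y}
    (hp : Function.Injective p) (hq : Function.Injective q) (hgh : ∀ i j, p i = q j → g i = h j)
    (r : ((Set.range p ∪ Set.range q)ᶜ : Set X) → Y) :
    ∃ f : X → Y, (∀ i, f (p i) = g i) ∧ (∀ j, f (q j) = h j) ∧
      ∀ x : ((Set.range p ∪ Set.range q)ᶜ : Set X), f x = r x := by
  obtain ⟨y⟩ := ‹Nonempty Y›
  refine ⟨Function.extend p g (Function.extend q h (Function.extend Subtype.val r fun _ => y)),
    hp.extend_apply _ _, fun j => ?_, fun x => ?_⟩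
  · by_cases hj : ∃ i, p i = q j
    · obtain ⟨i, hij⟩ := hj
      rw [← hij, hp.extend_apply, hgh i j hij]
    · rw [Function.extend_apply' _ _ _ hj, hq.extend_apply]
  · rw [Function.extend_apply' _ _ _ fun hx => x.2 (.inl hx),
      Function.extend_apply' _ _ _ fun hx => x.2 (.inr hx), Subtype.val_injective.extend_apply]

namespace IsAECCovering

open AbstractClass

variable {K : AbstractClass.{u} groupLang} (hcov : IsAECCovering W K)
  (hW : IsNontrivialVariety.{u} W) (hB : IsRCPWitness W B a b)
include hcov hW hB

theorem strong_of_isBranch (hc : IsFreeBasis W c) (hp : Function.Injective p)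
    (hinf : (Set.range p)ᶜ.Infinite) (h : IsBranch W a b c p m β) :
    ∃ hinj : Function.Injective m, K.Strong (homEmb m hinj) := by
  classical
  have := hinf.to_subtype
  have hbasis : IsFreeBasis W
      (Sum.elim (fun i => c (p i)) fun x : ((Set.range p)ᶜ : Set X) => c x) := by
    refine hc.reindex_bijective _ (((Equiv.ofInjective p hp).sumCongr (Equiv.refl _)).trans
      (Equiv.Set.sumCompl (Set.range p))).bijective ?_
    rintro (i | x) <;> rfl
  exact hcov.strong_of_witness hW hB hbasis h.basis h.map_branch fun _ => rfl

theorem strong_of_splitsAt {k : ℕ} (hpq : SplitsAt p q k) (hp : Function.Injective p)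
    (hq : Function.Injective q) {s : Set X} (hs : s = (Set.range p ∪ Set.range q)ᶜ)
    (hinf : s.Infinite) {Z : Type*} {z : Z → B}
    (hz : IsFreeBasis W (Sum.elim (fun j : {j | j ≤ k} => a j) z))
    (h : IsBranch W a b c p m β) {γ γ' : B →* Q} {r : s → Q}
    (hbasis : IsFreeBasis W (Sum.elim (fun i => γ' (b i)) (Sum.elim r fun t => γ (z t))))
    {i : P →* Q} (hi : i.comp β = γ) (hiq : ∀ j, i (m (c (q j))) = γ' (a j))
    (hir : ∀ x : s, i (m (c x)) = r x) :
    ∃ hinj : Function.Injective i, K.Strong (homEmb i hinj) := by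
  subst hs
  have := hinf.to_subtype
  refine hcov.strong_of_witness hW hB (h.isFreeBasis_of_splitsAt hB.free_b hpq hp hq hz) hbasis
    hiq ?_
  rintro (x | t)
  · exact hir x
  · exact DFunLike.congr_fun hi (z t)

theorem exists_amalgam_of_splitsAt {X : Type u} {c : X → M} {p q : ℕ → X} {k : ℕ}
    (hc : IsFreeBasis W c) (hpq : SplitsAt p q k) (hp : Function.Injective p)
    (hq : Function.Injective q) (hinf : (Set.range p ∪ Set.range q)ᶜ.Infinite)
    {P₁ P₂ : Type u} [Group P₁] [Group P₂]
    {m₁ : M →* P₁} {β₁ : B →* P₁} (h₁ : IsBranch W a b c p m₁ β₁)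
    {m₂ : M →* P₂} {β₂ : B →* P₂} (h₂ : IsBranch W a b c q m₂ β₂) :
    ∃ (Q : Type u) (_ : Group Q) (i₁ : P₁ →* Q) (i₂ : P₂ →* Q)
      (hi₁ : Function.Injective i₁) (hi₂ : Function.Injective i₂),
      K.Strong (homEmb i₁ hi₁) ∧ K.Strong (homEmb i₂ hi₂) ∧
      (∀ x, i₁ (m₁ x) = i₂ (m₂ x)) ∧ ∀ y, i₁ (β₁ (b 0)) ≠ i₂ (β₂ y) := by
  obtain ⟨Z, z, hz⟩ := hB.exists_basis k
  obtain ⟨Q, _, r, γ₁, γ₂, hγ⟩ :=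
    hz.exists_isDouble ((Set.range p ∪ Set.range q)ᶜ : Set X)
  have hQ := hγ.basis.1
  obtain ⟨f, hfp, hfq, hfr⟩ := exists_extend_two (g := fun i => γ₁ (a i)) (h := fun j => γ₂ (a j))
    hp hq (fun i j hij => by
      obtain ⟨rfl, hi⟩ := hpq.eq_and_le i j hij
      exact hγ.agree ⟨i, hi⟩) r
  obtain ⟨i₁, hβ₁, hm₁⟩ := h₁.exists_lift hB.free_b hQ γ₁ f hfp
  obtain ⟨i₂, hβ₂, hm₂⟩ := h₂.exists_lift hB.free_b hQ γ₂ f hfq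
  obtain ⟨hi₁, hstrong₁⟩ := hcov.strong_of_splitsAt hW hB hpq hp hq rfl hinf hz h₁
    (hz.replace hB.free_b hγ.symm.basis) hβ₁ (fun j => (hm₁ _).trans (hfq j))
    fun x => (hm₁ _).trans (hfr x)
  obtain ⟨hi₂, hstrong₂⟩ := hcov.strong_of_splitsAt hW hB hpq.symm hq hp
    (congrArg compl (Set.union_comm _ _)) hinf hz h₂ (hz.replace hB.free_b hγ.basis) hβ₂
    (fun j => (hm₂ _).trans (hfp j)) fun x => (hm₂ _).trans (hfr x)
  refine ⟨Q, _, i₁, i₂, hi₁, hi₂, hstrong₁, hstrong₂, fun x => ?_, fun y hy => ?_⟩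
  · have : i₁.comp m₁ = i₂.comp m₂ := hc.hom_ext hQ fun x => (hm₁ x).trans (hm₂ x).symm
    exact DFunLike.congr_fun this x
  · have hγy : γ₁ (b 0) = γ₂ y := by rw [← hβ₁, ← hβ₂]; exact hy
    refine hB.b_zero_notMem hW (Subgroup.closure_mono ?_ (hγ.mem_closure_of_apply_eq hz hγy))
    rintro _ ⟨j, rfl⟩
    exact ⟨j, rfl⟩

end IsAECCovering

end Branches

section Tree

variable {I : Type*}

/-- The `i`-th node on the branch `ν` of the tree of finite sequences. -/
def treeNode (ν : ℕ → I) (i : ℕ) : List I := (List.range i).map ν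

theorem length_treeNode (ν : ℕ → I) (i : ℕ) : (treeNode ν i).length = i := by
  simp [treeNode]

theorem treeNode_injective (ν : ℕ → I) : Function.Injective (treeNode ν) :=
  fun i j h => by rw [← length_treeNode ν i, h, length_treeNode]

theorem treeNode_eq_iff {ν η : ℕ → I} {i : ℕ} :
    treeNode ν i = treeNode η i ↔ ∀ j < i, ν j = η j := by
  simp [treeNode]

theorem exists_splitsAt_treeNode {ν η : ℕ → I} (h : ν ≠ η) :
    ∃ k, SplitsAt (treeNode ν) (treeNode η) k := by
  classical
  have h' : ∃ k, ν k ≠ η k := Function.ne_iff.1 h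
  refine ⟨Nat.find h', fun j hj => ?_, fun i j hij => ?_⟩
  · exact treeNode_eq_iff.2 fun i hi => not_not.1 (Nat.find_min h' (hi.trans_le hj))
  · obtain rfl : i = j := by rw [← length_treeNode ν i, hij, length_treeNode]
    exact ⟨rfl, not_lt.1 fun hlt => Nat.find_spec h' (treeNode_eq_iff.1 hij _ hlt)⟩

theorem infinite_compl_range_treeNode_union [Infinite I] (ν η : ℕ → I) :
    (Set.range (treeNode ν) ∪ Set.range (treeNode η))ᶜ.Infinite := by
  have hfin : ({ν 0, η 0} : Set I)ᶜ.Infinite := (Set.toFinite _).infinite_compl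
  refine (hfin.image (List.singleton_injective.injOn)).mono ?_
  rintro _ ⟨x, hx, rfl⟩
  have eq_apply_zero (μ : ℕ → I) (i) (hi : treeNode μ i = [x]) : x = μ 0 := by
    obtain rfl : i = 1 := by rw [← length_treeNode μ i, hi, List.length_singleton]
    simpa [treeNode] using hi.symm
  rintro (⟨i, hi⟩ | ⟨i, hi⟩)
  · exact hx (.inl (eq_apply_zero ν i hi))
  · exact hx (.inr (eq_apply_zero η i hi))

end Tree

theorem exists_lt_power_aleph0 (μ : Cardinal.{u}) :
    ∃ lam, μ ≤ lam ∧ ℵ₀ ≤ lam ∧ lam < lam ^ ℵ₀ := by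
  have hinf := aleph0_le_aleph (μ.ord + Ordinal.omega0)
  refine ⟨ℵ_ (μ.ord + Ordinal.omega0),
    (le_aleph_ord μ).trans (aleph_le_aleph.2 le_self_add), hinf, ?_⟩
  have hlt := lt_power_cof_ord hinf
  rwa [ord_aleph, Ordinal.cof_omega (Ordinal.isSuccLimit_add _ Ordinal.isSuccLimit_omega0),
    Ordinal.cof_add _ Ordinal.omega0_ne_zero, Ordinal.cof_omega0] at hlt

section Variety

variable {W : Set (FreeGroup ℕ)}

theorem IsFreeBasis.mk_eq {G X : Type u} [Group G] [Infinite X] {c : X → G}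
    (hc : IsFreeBasis W c) (hW : IsNontrivialVariety.{u} W) : #G = #X := by
  have hsurj : Function.Surjective (FreeGroup.lift c) := by
    rw [← MonoidHom.range_eq_top, FreeGroup.range_lift_eq_closure, hc.closure_range]
  have hle : #G ≤ #X := (mk_le_of_surjective hsurj).trans_eq (by
    rw [mk_freeGroup, max_eq_left (aleph0_le_mk X)])
  exact hle.antisymm (mk_le_of_injective (hc.injective hW))

namespace IsAECCovering

open AbstractClass

variable {K : AbstractClass.{u} groupLang} {B : Type u} [Group B] {a b : ℕ → B}
  (hcov : IsAECCovering W K) (hW : IsNontrivialVariety.{u} W) (hB : IsRCPWitness W B a b)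
  (hSE : IsStrongEnough W K B a b)
include hcov hW hB hSE

/-- If the types were equal, an automorphism `f` of a monster model fixing `M` would carry `b 0` of
the second copy of `B` to `b 0` of the first one, outside of the second copy; but this copy is the
definable closure of `A ∪ {b 0}`, hence of `A ∪ {f (b 0)}`. -/
theorem galoisType_ne_of_splitsAt {M P₁ P₂ : Type u} [Group M] [Group P₁] [Group P₂] {X : Type u}
    {c : X → M} {p q : ℕ → X} {k : ℕ} (hc : IsFreeBasis W c) (hpq : SplitsAt p q k)
    (hp : Function.Injective p) (hq : Function.Injective q)
    (hinf : (Set.range p ∪ Set.range q)ᶜ.Infinite)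
    {m₁ : M →* P₁} {β₁ : B →* P₁} (h₁ : IsBranch W a b c p m₁ β₁)
    {m₂ : M →* P₂} {β₂ : B →* P₂} (h₂ : IsBranch W a b c q m₂ β₂)
    {hm₁ : Function.Injective m₁} {hm₂ : Function.Injective m₂}
    (hs₁ : K.Strong (homEmb m₁ hm₁)) (hs₂ : K.Strong (homEmb m₂ hm₂)) :
    galoisType hs₁ (β₁ (b 0)) ≠ galoisType hs₂ (β₂ (b 0)) := by
  intro htype
  obtain ⟨Q, _, i₁, i₂, hi₁, hi₂, hsi₁, hsi₂, hi, hne⟩ :=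
    hcov.exists_amalgam_of_splitsAt hW hB hc hpq hp hq hinf h₁ h₂
  obtain ⟨hβ₂, hsβ₂⟩ := hcov.strong_of_basis hW hB.free_b h₂.basis
  obtain ⟨κ₀, hκ₀⟩ := hSE.dcl_aut
  obtain ⟨κ, hκ, N, _, k, f, hN, hk, hfix, hf⟩ :=
    hcov.isAEC.exists_monster_automorphism hcov.ap hcov.jep htype hsi₁ hsi₂ hi κ₀
  let j : B ↪[groupLang] N := (k.comp (homEmb i₂ hi₂)).comp (homEmb β₂ hβ₂)
  have hj : K.Strong j := hcov.isAEC.strong_comp hsβ₂ (hcov.isAEC.strong_comp hsi₂ hk)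
  have hfj : ∀ x ∈ Subgroup.closure (Set.range a), f (j x) = j x := by
    have hle : Subgroup.closure (Set.range a) ≤ m₂.range.comap β₂ := by
      rw [Subgroup.closure_le]
      rintro _ ⟨i, rfl⟩
      exact ⟨c (q i), h₂.map_branch i⟩
    intro x hx
    obtain ⟨g, hg⟩ := hle hx
    have hjx : j x = k (i₁ (m₁ g)) := by
      rw [hi, hg]
      rfl
    rw [hjx]
    exact hfix g
  have hrange : Set.range j =
      dclQF groupLang (j '' (Subgroup.closure (Set.range a) : Set B) ∪ {f (j (b 0))}) := by
    have hdcl : j '' dclQF groupLang ((Subgroup.closure (Set.range a) : Set B) ∪ {b 0}) =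
        dclQF groupLang (j '' ((Subgroup.closure (Set.range a) : Set B) ∪ {b 0})) :=
      hSE.dcl_eq (asStr groupLang N) j hj
    rw [hB.dcl_eq, Set.image_union, Set.image_singleton, Set.image_univ] at hdcl
    exact hdcl.trans (hκ₀ κ hκ (asStr groupLang N) hN j hj f hfj)
  have hmem : f (j (b 0)) ∈ Set.range j := hrange ▸ fun T hT => hT.1 (.inr rfl)
  obtain ⟨y, hy⟩ := hmem
  exact hne y (k.injective (hf.symm.trans hy.symm))

theorem not_isSuperstable : ¬ K.IsSuperstable := by
  rintro ⟨μ, hμ⟩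
  obtain ⟨lam, hle, hinf, hlt⟩ := exists_lt_power_aleph0 μ
  let I : Type u := lam.out
  have hI : #I = lam := mk_out lam
  have : Infinite I := infinite_iff.2 (hI ▸ hinf)
  let M : Type u := VFree W (List I)
  have hc : IsFreeBasis W (VFree.of W : List I → M) := isFreeBasis_vfree_of _
  have hM : #M = lam := by rw [hc.mk_eq hW, mk_list_eq_mk, hI]
  choose P _ m β hP using fun ν : ℕ → I =>
    hc.exists_isBranch (a := a) hB.free_b (treeNode_injective ν)
  choose hm hs using fun ν : ℕ → I => hcov.strong_of_isBranch hW hB hc (treeNode_injective ν)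
    ((infinite_compl_range_treeNode_union ν ν).mono (by simp only [Set.union_self, subset_rfl]))
    (hP ν)
  have htype : Function.Injective fun ν => galoisType (hs ν) (β ν (b 0)) := by
    intro ν η hνη
    by_contra hne
    obtain ⟨k, hk⟩ := exists_splitsAt_treeNode hne
    exact hcov.galoisType_ne_of_splitsAt hW hB hSE hc hk (treeNode_injective ν)
      (treeNode_injective η) (infinite_compl_range_treeNode_union ν η) (hP ν) (hP η) (hs ν)
      (hs η) hνη
  have hstable := hμ lam hle (asStr groupLang M) (hcov.mem_of_basis hW hc) hM
  have hcard := lift_mk_le_lift_mk_of_injective htype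
  rw [mk_arrow, hI, mk_nat, lift_uzero, lift_aleph0] at hcard
  exact (Cardinal.lift_le.1 ((hcard.trans_eq (lift_id'.{u, u + 1} _)).trans hstable)).not_gt hlt

end IsAECCovering

end Variety

end ConstructionPrinciple

theorem corollary1p9_general (W : Set (FreeGroup ℕ)) (hℤ : InVariety W (Multiplicative ℤ))
    (hroot : ∀ (F : Type u) [Group F] (X : Set F), IsFreeBasis W (fun x : X => (x : F)) →
      ∀ x ∈ X, ∀ y : F, x ^ 2 = y ^ 2 → x = y) :
    (∀ (B : Type u) [Group B] (b : ℕ → B), IsFreeBasis W b →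
      IsRCPWitness W B (fun i => b i * (b (i + 1)) ^ (-2 : ℤ)) b) ∧
    RCP.{u} W ∧
    (∀ (B : Type u) [Group B] (a b : ℕ → B), IsRCPWitness W B a b →
      ∀ K : AbstractClass.{u} groupLang, IsAECCovering W K → IsStrongEnough W K B a b →
        ¬ K.IsSuperstable) := by
  have hW : IsNontrivialVariety.{u} W := InVariety.isNontrivialVariety hℤ
  have hwit : ∀ (B : Type u) [Group B] (b : ℕ → B), IsFreeBasis W b →
      IsRCPWitness W B (fun i => b i * (b (i + 1)) ^ (-2 : ℤ)) b := by
    intro B _ b hb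
    refine hb.isRCPWitness_sqrtTwist hℤ fun i y hy => ?_
    have hsq : b i ^ 2 = y ^ 2 := by rw [pow_two, pow_two, hy]
    exact (hroot B _ (hb.subtype_range (hb.injective hW)) (b i) ⟨i, rfl⟩ y hsq).symm
  have hfree := (isFreeBasis_vfree_of (W := W) (ULift.{u} ℕ)).reindex Equiv.ulift.symm
  exact ⟨hwit, ⟨_, _, _, _, hwit _ _ hfree⟩,
    fun B _ a b hB K hcov hSE => hcov.not_isSuperstable hW hB hSE⟩

theorem corollary1p9 (W : Set (FreeGroup ℕ)) (htf : IsTorsionFreeVariety.{u} W)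
    (hroot : ∀ (F : Type u) [Group F] (X : Set F), IsFreeBasis W (fun x : X => (x : F)) →
      ∀ x ∈ X, ∀ (y : F) (n : ℕ), 0 < n → x ^ n = y ^ n → x = y) :
    (∀ (B : Type u) [Group B] (b : ℕ → B), IsFreeBasis W b →
      IsRCPWitness W B (fun i => b i * (b (i + 1)) ^ (-2 : ℤ)) b) ∧
    RCP.{u} W ∧
    (∀ (B : Type u) [Group B] (a b : ℕ → B), IsRCPWitness W B a b →
      ∀ K : AbstractClass.{u} groupLang, IsAECCovering W K → IsStrongEnough W K B a b →
        ¬ K.IsSuperstable) :=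
  corollary1p9_general W htf.inVariety_int fun F _ X hX x hx y => hroot F X hX x hx y 2 two_pos
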